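/- For $A\in\mathbb Z^{d\times n}$ let $\operatorname{cone}(A)\subseteq\mathbb R^d$ be the set of nonnegative real linear combinations of the columns of $A$, and for an integer $k\ge 0$ let $$\mathrm{Sg}_{<k}(A)=\bigl\{\,b\in \operatorname{cone}(A)\cap\mathbb Z^d \;:\; \#\{x\in\mathbb Z^n : Ax=b,\ x\ge 0\}<k\,\bigr\}$$ be the set of $k$-holes of the semigroup $\mathrm{Sg}(A)=\{Ax : x\in\mathbb Z^n,\ x\ge 0\}$. **Theorem.** There is an algorithm (a single computable function) which, given an integer $k\ge 0$ and an integral matrix $A\in\mathbb Z^{d\times n}$ of arbitrary size, computes a finite explicit representation of $\mathrm{Sg}_{<k}(A)$: it outputs finitely many vectors $h_i\in\mathbb Z^d$ and, for each $i$, a finite list of generators in $\mathbb Z^d$ of an affine semigroup $M_i\subseteq\mathbb Z^d$ (a semigroup containing $0$; $M_i=\{0\}$ is allowed), $i\in I$, such that $$\mathrm{Sg}_{<k}(A)=\bigcup_{i\in I}\,(h_i+M_i).$$ Here $I$ may be empty. -/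

import Mathlib

open scoped Matrix

namespace KHoles

/-- The polyhedral cone `cone(A)` in `ℝ^d`: all nonnegative real linear combinations of the
columns of `A`. -/
def cone {d n : ℕ} (A : Matrix (Fin d) (Fin n) ℤ) : Set (Fin d → ℝ) :=
  {v | ∃ c : Fin n → ℝ, 0 ≤ c ∧ (A.map fun a : ℤ => (a : ℝ)) *ᵥ c = v}

/-- The integer points of the parametric polyhedron `P_A(b) = {x : A x = b, x ≥ 0}`. -/
def integerPoints {d n : ℕ} (A : Matrix (Fin d) (Fin n) ℤ) (b : Fin d → ℤ) :
    Set (Fin n → ℤ) :=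
  {x | A *ᵥ x = b ∧ 0 ≤ x}

/-- The set `Sg_{<k}(A)` of `k`-holes: the integer vectors `b` in `cone(A)` such that `P_A(b)` has
fewer than `k` integer points. (An infinite set of integer points has `encard = ⊤`.) -/
def kHoles {d n : ℕ} (k : ℕ) (A : Matrix (Fin d) (Fin n) ℤ) : Set (Fin d → ℤ) :=
  {b | (fun i => (b i : ℝ)) ∈ cone A ∧ (integerPoints A b).encard < (k : ℕ∞)}

/-- The translated affine semigroup `h + M`, where `M ⊆ ℤ^d` is the semigroup with zero generated
by the finite list `gens`. -/
def translatedSemigroup {d : ℕ} (h : Fin d → ℤ) (gens : List (Fin d → ℤ)) : Set (Fin d → ℤ) :=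
  {b | ∃ m ∈ AddSubmonoid.closure {g : Fin d → ℤ | g ∈ gens}, b = h + m}

/-- An integer vector written as the list of its entries. -/
def vecCode {d : ℕ} (v : Fin d → ℤ) : List ℤ :=
  List.ofFn v

/-- An integer matrix written as the list of its rows, each the list of its entries. -/
def matrixCode {d n : ℕ} (A : Matrix (Fin d) (Fin n) ℤ) : List (List ℤ) :=
  List.ofFn fun i => vecCode (A i)

/-- A finite family of pairs (translation vector `h`, finite list of generators), written with
lists of integers. -/
def reprCode {d : ℕ} (R : List ((Fin d → ℤ) × List (Fin d → ℤ))) :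
    List (List ℤ × List (List ℤ)) :=
  R.map fun p => (vecCode p.1, p.2.map vecCode)

end KHoles

namespace KHoles

/-! Rounding down the coefficients of a real cone representation writes every integer point of the
cone as `f + A x` with `x` in `ℕ^n` and `f` in a finite set `F` of integer points of the cone. For
fixed `f`, the set `J_f` of all `x` for which `f + A x` has at least `k` nonnegative solutions is an
upper set of `ℕ^n`, since adding `y ≥ 0` to solutions is injective. The `k`-holes are thus the
images of the complements of these monomial ideals, and such complements are finite unions of
regions `p + ℕ^s`.

To find the regions effectively, cut at a level `T`: `ℕ^n` is partitioned into the regions `p + ℕ^s`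
with `0 ≤ p ≤ T` and `s = {j | p j = T}`. A region meets `J_f` exactly when `A z = f + A p` has at
least `k` integer solutions that are nonnegative outside `s` (`encard_integerPoints_add_lt`,
`exists_le_encard_integerPoints_add`). If every region meeting `J_f` already starts in `J_f`, the
other regions are the wanted pieces. Dickson's lemma shows that some `T` has this property
(`exists_isSeparating`); no bound on `T` is needed, because the property is decidable and can be
searched for.

Decidability rests on Cramer bounds for support-minimal kernel vectors: they confine cone membership
(`mem_cone_iff`) and the comparison of solution counts with `k` (`le_encard_signedPoints_iff`) to
explicit boxes. -/

/-- An upper bound for the entries of the support-minimal integer vectors in the kernel of a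
`d × n` integer matrix with entries of absolute value at most `e`. -/
def kernelBound (d n e : ℕ) : ℕ := (n * (d * e ^ 2 + 1)) ^ n

/-- The Leibniz bound `s! x ^ s`, coarsened. The `+ 1` in `kernelBound` keeps the base positive even
if `d * e ^ 2 = 0`, so that the exponent may be raised to `n`. -/
theorem abs_det_le_kernelBound {s : Type*} [Fintype s] [DecidableEq s] {d n e : ℕ}
    (hn : 0 < n) (hs : Fintype.card s ≤ n) (G : Matrix s s ℤ)
    (hG : ∀ i j, |G i j| ≤ (d * e ^ 2 : ℕ)) : |G.det| ≤ (kernelBound d n e : ℕ) := by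
  have h := Matrix.det_le (A := G) (abv := AbsoluteValue.abs) (x := ((d * e ^ 2 : ℕ) : ℤ)) hG
  have h' : |G.det| ≤ ((Fintype.card s).factorial * (d * e ^ 2) ^ Fintype.card s : ℕ) := by
    simpa using h
  refine h'.trans ?_
  have : (Fintype.card s).factorial * (d * e ^ 2) ^ Fintype.card s ≤ kernelBound d n e := by
    calc (Fintype.card s).factorial * (d * e ^ 2) ^ Fintype.card s
        ≤ n ^ Fintype.card s * (d * e ^ 2 + 1) ^ Fintype.card s := by
          gcongr
          · exact (Nat.factorial_le_pow _).trans (Nat.pow_le_pow_left hs _)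
          · omega
      _ = (n * (d * e ^ 2 + 1)) ^ Fintype.card s := by rw [mul_pow]
      _ ≤ _ := Nat.pow_le_pow_right (by positivity) hs
  exact_mod_cast this

theorem abs_sum_mul_le {m : Type*} [Fintype m] {e : ℕ} (v w : m → ℤ) (hv : ∀ i, |v i| ≤ e)
    (hw : ∀ i, |w i| ≤ e) : |∑ i, v i * w i| ≤ (Fintype.card m * e ^ 2 : ℕ) := by
  calc |∑ i, v i * w i| ≤ ∑ i, |v i * w i| := Finset.abs_sum_le_sum_abs _ _
    _ ≤ ∑ _i : m, (e : ℤ) ^ 2 := by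
        refine Finset.sum_le_sum fun i _ => ?_
        rw [abs_mul, pow_two]
        exact mul_le_mul (hv i) (hw i) (abs_nonneg _) (by positivity)
    _ = _ := by simp

/-! ### Bounded integer kernel vectors of small support -/

section Kernel

variable {m ι : Type*} [Fintype m] [Fintype ι] [DecidableEq ι]

/-- Deleting one support column `j0` leaves independent columns `N`, and Cramer's rule for the
normal equations with Gram matrix `Nᵀ N` expresses `y`, up to a positive factor, by integer
determinants. The Gram matrix spares the choice of independent rows; its entries are at most `d e ^
2`, for `d` the number of rows. -/
theorem exists_int_multiple_of_kernel_line (M : Matrix m ι ℤ) {e : ℕ} (he : ∀ i j, |M i j| ≤ e)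
    (y : ι → ℝ) (y0 : y ≠ 0) (hy : 0 ≤ y) (hM : (M.map fun a : ℤ => (a : ℝ)) *ᵥ y = 0)
    (hline : ∀ w : ι → ℝ, (M.map fun a : ℤ => (a : ℝ)) *ᵥ w = 0 → (∀ j, y j = 0 → w j = 0) →
      ∃ α : ℝ, w = α • y) :
    ∃ (u : ι → ℤ) (c : ℝ), 0 < c ∧ (∀ j, (u j : ℝ) = c * y j) ∧
      ∀ j, u j ≤ kernelBound (Fintype.card m) (Fintype.card ι) e := by
  classical
  obtain ⟨j0, hj0⟩ : ∃ j, y j ≠ 0 := Function.ne_iff.mp y0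
  let P : ι → Prop := fun j => y j ≠ 0 ∧ j ≠ j0
  let N : Matrix m (Subtype P) ℤ := M.submatrix id Subtype.val
  let NR : Matrix m (Subtype P) ℝ := N.map fun a : ℤ => (a : ℝ)
  have split : ∀ w : ι → ℝ, (∀ j, y j = 0 → w j = 0) → ∀ i,
      ((M.map fun a : ℤ => (a : ℝ)) *ᵥ w) i =
        M i j0 * w j0 + (NR *ᵥ fun j : Subtype P => w j) i := by
    intro w hw i
    simp only [Matrix.mulVec, dotProduct, Matrix.map_apply, NR, N, Matrix.submatrix_apply, id]
    rw [← Finset.add_sum_erase _ _ (Finset.mem_univ j0),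
      ← Finset.sum_subtype (Finset.univ.filter P) (by simp [P]) (fun j => (M i j : ℝ) * w j)]
    congr 1
    symm
    apply Finset.sum_subset
    · intro j hj
      simp only [Finset.mem_filter, P] at hj
      simp [hj.2.2]
    · intro j hj hj'
      have : y j = 0 := by
        by_contra h
        exact hj' (by simpa [P, h] using hj)
      simp [hw j this]
  -- A kernel vector of `N`, extended by zero, lies on the line through `y`; it vanishes at `j0`,
  -- where `y` does not, so it is zero.
  have inj : Function.Injective NR.mulVec := by
    refine (injective_iff_map_eq_zero NR.mulVecLin).mpr fun c hc => ?_
    rw [Matrix.mulVecLin_apply] at hc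
    let w : ι → ℝ := fun j => if h : P j then c ⟨j, h⟩ else 0
    have hw : ∀ j, y j = 0 → w j = 0 := fun j hj => by simp [w, P, hj]
    have hwc : (fun j : Subtype P => w j) = c := by
      ext j
      simp [w, j.2]
    have hw0 : w j0 = 0 := by simp [w, P]
    obtain ⟨α, hα⟩ := hline w (by
      ext i
      rw [split w hw i, hwc, hc, hw0]
      simp) hw
    have : α = 0 := by
      have := congrFun hα j0
      rw [hw0] at this
      simpa [hj0] using this.symm
    rw [← hwc, hα, this]
    ext j
    simp
  have hpos : 0 < (NRᵀ * NR).det := by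
    simpa [Matrix.conjTranspose_eq_transpose_of_trivial] using
      (Matrix.PosDef.conjTranspose_mul_self NR inj).det_pos
  let G : Matrix (Subtype P) (Subtype P) ℤ := Nᵀ * N
  let b : Subtype P → ℤ := -(Nᵀ *ᵥ fun i => M i j0)
  have hGR : (G.map fun a : ℤ => (a : ℝ)) = NRᵀ * NR := by
    have := Matrix.map_mul (L := Nᵀ) (M := N) (f := Int.castRingHom ℝ)
    exact this
  have hbR : (fun j => (b j : ℝ)) = -(NRᵀ *ᵥ fun i => (M i j0 : ℝ)) := by
    ext j
    simp [b, NR, Matrix.mulVec, dotProduct]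
  have hdet : (G.det : ℝ) = (NRᵀ * NR).det := by rw [Int.cast_det, hGR]
  have hNy : NR *ᵥ (fun j : Subtype P => y j) = -(y j0 • fun i => (M i j0 : ℝ)) := by
    ext i
    have h1 := split y (fun _ h => h) i
    rw [hM] at h1
    simp only [Pi.zero_apply, Pi.neg_apply, Pi.smul_apply, smul_eq_mul] at h1 ⊢
    linarith
  have hGy : (NRᵀ * NR) *ᵥ (fun j : Subtype P => y j) = y j0 • fun j => (b j : ℝ) := by
    rw [← Matrix.mulVec_mulVec, hNy, hbR, Matrix.mulVec_neg, Matrix.mulVec_smul, smul_neg]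
  have hcr : ∀ j, (G.cramer b j : ℝ) * y j0 = G.det * y j := by
    have h2 : (NRᵀ * NR).det • (fun j : Subtype P => y j) =
        y j0 • (NRᵀ * NR).cramer (fun j => (b j : ℝ)) := by
      rw [Matrix.cramer_eq_adjugate_mulVec, ← Matrix.mulVec_smul, ← hGy, Matrix.mulVec_mulVec,
        Matrix.adjugate_mul, Matrix.smul_mulVec, Matrix.one_mulVec]
    intro j
    have h3 := congrFun h2 j
    have h4 : (G.cramer b j : ℝ) = (NRᵀ * NR).cramer (fun j => (b j : ℝ)) j := by
      rw [Matrix.cramer_apply, Matrix.cramer_apply, Int.cast_det, ← hGR]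
      congr 1
      ext i k
      by_cases h : k = j <;> simp [h]
    rw [h4, hdet]
    simp only [Pi.smul_apply, smul_eq_mul] at h3
    rw [h3]
    ring
  have hy0 : 0 < y j0 := lt_of_le_of_ne (hy j0) (Ne.symm hj0)
  have hn : 0 < Fintype.card ι := Fintype.card_pos_iff.mpr ⟨j0⟩
  have hcard : Fintype.card (Subtype P) ≤ Fintype.card ι := Fintype.card_subtype_le _
  have hGb : ∀ i j, |G i j| ≤ (Fintype.card m * e ^ 2 : ℕ) := fun i j =>
    abs_sum_mul_le _ _ (fun k => he _ _) (fun k => he _ _)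
  have hbb : ∀ j, |b j| ≤ (Fintype.card m * e ^ 2 : ℕ) := fun j => by
    simp only [b, Pi.neg_apply, abs_neg]
    exact abs_sum_mul_le _ _ (fun k => he _ _) (fun k => he _ _)
  -- Scaling `y` so that its `j0` entry becomes `det G` makes all other support entries the Cramer
  -- determinants.
  refine ⟨fun j => if h : P j then G.cramer b ⟨j, h⟩ else if j = j0 then G.det else 0,
    G.det / y j0, div_pos (hdet ▸ hpos) hy0, fun j => ?_, fun j => ?_⟩
  · by_cases h : P j
    · have := hcr ⟨j, h⟩
      simp only [h, dif_pos]
      field_simp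
      linarith
    · by_cases h' : j = j0
      · subst h'
        simp only [h, dif_neg, not_false_eq_true, if_true]
        field_simp
      · have : y j = 0 := by
          by_contra h''
          exact h ⟨h'', h'⟩
        simp [h, h', this]
  · dsimp only
    split_ifs with h h'
    · rw [Matrix.cramer_apply]
      refine (le_abs_self _).trans (abs_det_le_kernelBound hn hcard _ fun i k => ?_)
      rw [Matrix.updateCol_apply]
      split_ifs
      · exact hbb i
      · exact hGb i k
    · exact (le_abs_self _).trans (abs_det_le_kernelBound hn hcard _ hGb)
    · positivity

/-- A nonzero nonnegative real vector in the kernel of an integer matrix supports a nonzero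
nonnegative integer kernel vector of bounded size. -/
theorem exists_bounded_int_kernel_vector (M : Matrix m ι ℤ) {e : ℕ} (he : ∀ i j, |M i j| ≤ e)
    (y : ι → ℝ) (y0 : y ≠ 0) (hy : 0 ≤ y) (hM : (M.map fun a : ℤ => (a : ℝ)) *ᵥ y = 0) :
    ∃ u : ι → ℤ, u ≠ 0 ∧ 0 ≤ u ∧ M *ᵥ u = 0 ∧ (∀ j, y j = 0 → u j = 0) ∧
      ∀ j, u j ≤ kernelBound (Fintype.card m) (Fintype.card ι) e := by
  classical
  induction hs : (Finset.univ.filter fun j => y j ≠ 0).card using Nat.strong_induction_on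
    generalizing y with
  | _ s ih =>
  by_cases hline : ∀ w : ι → ℝ, (M.map fun a : ℤ => (a : ℝ)) *ᵥ w = 0 →
      (∀ j, y j = 0 → w j = 0) → ∃ α : ℝ, w = α • y
  · obtain ⟨u, c, hc, hu, hb⟩ := exists_int_multiple_of_kernel_line M he y y0 hy hM hline
    refine ⟨u, ?_, fun j => ?_, ?_, fun j hj => ?_, hb⟩
    · rintro rfl
      refine y0 (funext fun j => ?_)
      simpa [hc.ne'] using (hu j).symm
    · have : (0 : ℝ) ≤ u j := by rw [hu]; exact mul_nonneg hc.le (hy j)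
      exact_mod_cast this
    · have hu' : (fun j => (u j : ℝ)) = c • y := funext hu
      have h1 : (M.map fun a : ℤ => (a : ℝ)) *ᵥ (fun j => (u j : ℝ)) = 0 := by
        rw [hu', Matrix.mulVec_smul, hM, smul_zero]
      ext i
      have := congrFun h1 i
      simp only [Matrix.mulVec, dotProduct, Matrix.map_apply, Pi.zero_apply] at this ⊢
      exact_mod_cast this
    · have := hu j
      rw [hj, mul_zero] at this
      exact_mod_cast this
  · push Not at hline
    obtain ⟨w, hw, hws, hwy⟩ := hline
    -- Up to sign `w` has a positive entry, as the ratio test below requires.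
    obtain ⟨w, hw, hws, hwy, j1, hj1⟩ : ∃ w : ι → ℝ, (M.map fun a : ℤ => (a : ℝ)) *ᵥ w = 0 ∧
        (∀ j, y j = 0 → w j = 0) ∧ (∀ α : ℝ, w ≠ α • y) ∧ ∃ j, 0 < w j := by
      by_cases hp : ∃ j, 0 < w j
      · exact ⟨w, hw, hws, hwy, hp⟩
      · push Not at hp
        refine ⟨-w, by rw [Matrix.mulVec_neg, hw, neg_zero], fun j hj => by simp [hws j hj],
          fun α h => hwy (-α) (by rw [neg_smul, ← h, neg_neg]), ?_⟩
        by_contra hq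
        push Not at hq
        refine hwy 0 (funext fun j => ?_)
        have h1 := hp j
        have h2 := hq j
        simp only [Pi.neg_apply, Pi.smul_apply, smul_eq_mul, zero_mul] at *
        linarith
    -- The least ratio `y k / w k` is the largest multiple of `w` that can be subtracted; it
    -- annihilates coordinate `k`, so the support shrinks.
    obtain ⟨k, hk, hmin⟩ := Finset.exists_min_image (Finset.univ.filter fun j => 0 < w j)
      (fun j => y j / w j) ⟨j1, by simpa using hj1⟩
    simp only [Finset.mem_filter, Finset.mem_univ, true_and] at hk hmin
    have hyk : y k ≠ 0 := fun h => hk.ne' (hws k h)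
    have hyk' : 0 < y k := lt_of_le_of_ne (hy k) (Ne.symm hyk)
    set t := y k / w k with ht
    have htpos : 0 < t := div_pos hyk' hk
    have hsub : ∀ j, y j = 0 → (y - t • w) j = 0 := fun j hj => by simp [hj, hws j hj]
    obtain ⟨u, h1, h2, h3, h4, h5⟩ := ih (Finset.univ.filter fun j => (y - t • w) j ≠ 0).card
      (by
        rw [← hs]
        refine Finset.card_lt_card (Finset.ssubset_iff_of_subset ?_ |>.mpr ⟨k, ?_, ?_⟩)
        · intro j
          simp only [Finset.mem_filter, Finset.mem_univ, true_and]
          exact fun h h' => h (hsub j h')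
        · simpa using hyk
        · simp only [Finset.mem_filter, Finset.mem_univ, true_and, not_not, Pi.sub_apply,
            Pi.smul_apply, smul_eq_mul, ht]
          field_simp
          simp)
      (y - t • w)
      (fun h => hwy t⁻¹ (by
        rw [sub_eq_zero.mp h, smul_smul, inv_mul_cancel₀ htpos.ne', one_smul]))
      (fun j => by
        simp only [Pi.zero_apply, Pi.sub_apply, Pi.smul_apply, smul_eq_mul, sub_nonneg]
        by_cases hj : 0 < w j
        · exact (le_div_iff₀ hj).mp (hmin j hj)
        · have := mul_nonneg htpos.le (sub_nonneg.mpr (not_lt.mp hj))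
          have := hy j
          simp only [Pi.zero_apply] at this
          linarith)
      (by rw [Matrix.mulVec_sub, Matrix.mulVec_smul, hM, hw, smul_zero, sub_zero]) rfl
    exact ⟨u, h1, h2, h3, fun j hj => h4 j (hsub j hj), h5⟩

end Kernel

theorem map_mulVec_cast {m ι : Type*} [Fintype ι] (M : Matrix m ι ℤ) (u : ι → ℤ) :
    ((M.map fun a : ℤ => (a : ℝ)) *ᵥ fun j => (u j : ℝ)) = fun i => ((M *ᵥ u) i : ℝ) := by
  ext i
  simp [Matrix.mulVec, dotProduct]

/-- Subtracting the largest multiple of an integer kernel vector keeps a real kernel vector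
nonnegative and shrinks its support. -/
theorem exists_sub_smul_support_lt {m ι : Type*} [Fintype ι] (M : Matrix m ι ℤ) (y : ι → ℝ) (hy : 0 ≤ y)
    (hM : (M.map fun a : ℤ => (a : ℝ)) *ᵥ y = 0) (u : ι → ℤ) (u0 : u ≠ 0) (hu : 0 ≤ u)
    (hMu : M *ᵥ u = 0) (hsupp : ∀ j, y j = 0 → u j = 0) :
    ∃ t : ℝ, 0 ≤ t ∧ (∀ j, t * u j ≤ y j) ∧
      (M.map fun a : ℤ => (a : ℝ)) *ᵥ (fun j => y j - t * u j) = 0 ∧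
      (Finset.univ.filter fun j => y j - t * u j ≠ 0).card <
        (Finset.univ.filter fun j => y j ≠ 0).card := by
  obtain ⟨j1, hj1⟩ : ∃ j, u j ≠ 0 := Function.ne_iff.mp u0
  have hupos : ∀ j, u j ≠ 0 → (0 : ℝ) < u j := fun j hj => by
    exact_mod_cast lt_of_le_of_ne (hu j) (Ne.symm hj)
  obtain ⟨k, hk, hmin⟩ := Finset.exists_min_image (Finset.univ.filter fun j => u j ≠ 0)
    (fun j => y j / u j) ⟨j1, by simpa using hj1⟩
  simp only [Finset.mem_filter, Finset.mem_univ, true_and] at hk hmin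
  have hyk : y k ≠ 0 := fun h => hk (hsupp k h)
  refine ⟨y k / u k, div_nonneg (hy k) (hupos k hk).le, fun j => ?_, ?_, ?_⟩
  · by_cases hj : u j = 0
    · simpa [hj] using hy j
    · exact (le_div_iff₀ (hupos j hj)).mp (hmin j hj)
  · have : (fun j => y j - y k / u k * u j) = y - (y k / u k) • fun j => (u j : ℝ) := rfl
    rw [this, Matrix.mulVec_sub, Matrix.mulVec_smul, hM, map_mulVec_cast, hMu]
    ext i
    simp
  · refine Finset.card_lt_card (Finset.ssubset_iff_of_subset ?_ |>.mpr ⟨k, ?_, ?_⟩)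
    · intro j
      simp only [Finset.mem_filter, Finset.mem_univ, true_and]
      exact fun h h' => h (by simp [h', hsupp j h'])
    · simpa using hyk
    · have := (hupos k hk).ne'
      simp only [Finset.mem_filter, Finset.mem_univ, true_and, not_not]
      field_simp
      simp

/-! ### Decomposition into bounded kernel vectors -/

section Kernel

variable {m ι : Type*} [Fintype m] [Fintype ι] [DecidableEq ι]

/-- Subtracting a bounded vector that vanishes at `t` preserves `y t` and shrinks the support, so
eventually a vector involving `t` must appear. -/
theorem exists_bounded_int_kernel_vector_pos (M : Matrix m ι ℤ) {e : ℕ}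
    (he : ∀ i j, |M i j| ≤ e) (t : ι) (y : ι → ℝ) (hy : 0 ≤ y)
    (hM : (M.map fun a : ℤ => (a : ℝ)) *ᵥ y = 0) (ht : 0 < y t) :
    ∃ u : ι → ℤ, 0 < u t ∧ 0 ≤ u ∧ M *ᵥ u = 0 ∧
      ∀ j, u j ≤ kernelBound (Fintype.card m) (Fintype.card ι) e := by
  induction hs : (Finset.univ.filter fun j => y j ≠ 0).card using Nat.strong_induction_on
    generalizing y with
  | _ s ih =>
  obtain ⟨u, h1, h2, h3, h4, h5⟩ := exists_bounded_int_kernel_vector M he y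
    (fun h => ht.ne' (congrFun h t)) hy hM
  by_cases hut : u t = 0
  · obtain ⟨c, hc, hle, hker, hlt⟩ := exists_sub_smul_support_lt M y hy hM u h1 h2 h3 h4
    exact ih _ (hs ▸ hlt) _ (fun j => sub_nonneg.mpr (hle j)) hker (by simpa [hut] using ht) rfl
  · exact ⟨u, lt_of_le_of_ne (h2 t) (Ne.symm hut), h2, h3, h5⟩

/-- Successive subtraction writes `y` as a sum of at most as many terms `c • u` as it has support
elements, each `u` bounded. Every `c` is at most `1`: otherwise either `u t = 0` and `u ≤ y`
contradicts minimality, or `u t ≥ 1` and `y t > 1`. -/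
theorem kernel_vector_le_of_minimal (M : Matrix m ι ℤ) {e : ℕ}
    (he : ∀ i j, |M i j| ≤ e) (t : ι) (y : ι → ℝ) (hy : 0 ≤ y)
    (hM : (M.map fun a : ℤ => (a : ℝ)) *ᵥ y = 0) (ht : y t ≤ 1)
    (hmin : ∀ u : ι → ℤ, 0 ≤ u → u t = 0 → M *ᵥ u = 0 → (∀ j, (u j : ℝ) ≤ y j) → u = 0) (j : ι) :
    y j ≤ (Finset.univ.filter fun j => y j ≠ 0).card *
      kernelBound (Fintype.card m) (Fintype.card ι) e := by
  induction hs : (Finset.univ.filter fun j => y j ≠ 0).card using Nat.strong_induction_on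
    generalizing y with
  | _ s ih =>
  by_cases y0 : y = 0
  · rw [y0, Pi.zero_apply]
    positivity
  obtain ⟨u, h1, h2, h3, h4, h5⟩ := exists_bounded_int_kernel_vector M he y y0 hy hM
  obtain ⟨c, hc, hle, hker, hlt⟩ := exists_sub_smul_support_lt M y hy hM u h1 h2 h3 h4
  have hu : ∀ j, (0 : ℝ) ≤ u j := fun j => by exact_mod_cast h2 j
  have hc1 : c ≤ 1 := by
    by_contra hcc
    push Not at hcc
    by_cases hut : u t = 0
    · refine h1 (hmin u h2 hut h3 fun j => (hle j).trans' ?_)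
      nlinarith [hu j]
    · have : (1 : ℤ) ≤ u t := lt_of_le_of_ne (h2 t) (Ne.symm hut)
      have : (1 : ℝ) ≤ u t := by exact_mod_cast this
      have := hle t
      nlinarith
  have hdec : ∀ j, y j - c * u j ≤ y j := fun j => by
    have := mul_nonneg hc (hu j)
    linarith
  have := ih _ (hs ▸ hlt) _ (fun j => sub_nonneg.mpr (hle j)) hker ((hdec t).trans ht)
    (fun v h6 h7 h8 h9 => hmin v h6 h7 h8 fun j => (h9 j).trans (hdec j)) rfl
  set K := kernelBound (Fintype.card m) (Fintype.card ι) e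
  have h5' : (u j : ℝ) ≤ K := by exact_mod_cast h5 j
  have hlt' : ((Finset.univ.filter fun j => y j - c * u j ≠ 0).card : ℝ) + 1 ≤ s := by
    exact_mod_cast hs ▸ hlt
  have hcu : c * u j ≤ K := by nlinarith [hu j]
  have hK : (0 : ℝ) ≤ K := by positivity
  nlinarith

end Kernel

/-! ### Boxes for nonnegative integer solutions -/

section Solutions

variable {d n : ℕ}

/-- The matrix `[A | -g]`, whose kernel vectors with last entry `1` are the solutions of
`A x = g`. -/
def homogenize (A : Matrix (Fin d) (Fin n) ℤ) (g : Fin d → ℤ) :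
    Matrix (Fin d) (Option (Fin n)) ℤ :=
  fun i j => j.elim (-g i) (A i)

theorem homogenize_mulVec_real (A : Matrix (Fin d) (Fin n) ℤ) (g : Fin d → ℤ)
    (x : Fin n → ℝ) (t : ℝ) :
    ((homogenize A g).map fun a : ℤ => (a : ℝ)) *ᵥ (fun j : Option (Fin n) => j.elim t x) =
      (A.map fun a : ℤ => (a : ℝ)) *ᵥ x - t • fun i => (g i : ℝ) := by
  ext i
  simp [Matrix.mulVec, dotProduct, homogenize, Fintype.sum_option]
  ring

theorem homogenize_mulVec (A : Matrix (Fin d) (Fin n) ℤ) (g : Fin d → ℤ)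
    (u : Option (Fin n) → ℤ) :
    homogenize A g *ᵥ u = A *ᵥ (fun j => u (some j)) - u none • g := by
  ext i
  simp [Matrix.mulVec, dotProduct, homogenize, Fintype.sum_option]
  ring

/-- Coordinate bound for boxes in which the integer solutions of `A x = g` are counted up to
`k`. -/
def boxBound (k d n e : ℕ) : ℕ := (n + 1 + k) * kernelBound d (n + 1) e

theorem abs_homogenize_le {A : Matrix (Fin d) (Fin n) ℤ} {g : Fin d → ℤ} {e : ℕ}
    (hA : ∀ i j, |A i j| ≤ e) (hg : ∀ i, |g i| ≤ e) (i : Fin d) (j : Option (Fin n)) :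
    |homogenize A g i j| ≤ e := by
  cases j with
  | none => simpa [homogenize] using hg i
  | some j => exact hA i j

/-- The vector `(x, 1)` lies in the kernel of `[A | -g]`, and its support has at most `n + 1`
elements. -/
theorem le_of_minimal_solution {A : Matrix (Fin d) (Fin n) ℤ} {g : Fin d → ℤ} {e : ℕ}
    (hA : ∀ i j, |A i j| ≤ e) (hg : ∀ i, |g i| ≤ e) {x : Fin n → ℤ} (hx : x ∈ integerPoints A g)
    (hmin : ∀ u : Fin n → ℤ, 0 ≤ u → A *ᵥ u = 0 → u ≤ x → u = 0) (j : Fin n) :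
    x j ≤ ((n + 1) * kernelBound d (n + 1) e : ℕ) := by
  let y : Option (Fin n) → ℝ := fun j => j.elim 1 fun j => (x j : ℝ)
  have h := kernel_vector_le_of_minimal (homogenize A g) (abs_homogenize_le hA hg) none y
    (fun j => by
      cases j with
      | none => simp [y]
      | some j => simpa [y] using hx.2 j)
    (by
      rw [homogenize_mulVec_real, map_mulVec_cast, hx.1]
      ext i
      simp)
    (by simp [y])
    (fun u h1 h2 h3 h4 => by
      rw [homogenize_mulVec, h2, zero_smul, sub_zero] at h3
      have := hmin _ (fun j => h1 (some j)) h3 (fun j => by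
        have h5 : (u (some j) : ℝ) ≤ (x j : ℝ) := h4 (some j)
        exact_mod_cast h5)
      ext j
      cases j with
      | none => exact h2
      | some j => exact congrFun this j)
    (some j)
  have hcard : (Finset.univ.filter fun j => y j ≠ 0).card ≤ n + 1 := by
    simpa using Finset.card_le_univ (Finset.univ.filter fun j => y j ≠ 0)
  have h' : x j ≤ ((Finset.univ.filter fun j => y j ≠ 0).card * kernelBound d (n + 1) e : ℕ) := by
    have h : (x j : ℝ) ≤ _ := h
    simp only [Fintype.card_fin, Fintype.card_option] at h
    exact_mod_cast h
  refine h'.trans ?_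
  exact_mod_cast Nat.mul_le_mul_right _ hcard

/-- A solution of least coordinate sum works: subtracting `u` would otherwise lower the sum. -/
theorem exists_sum_minimal_solution {A : Matrix (Fin d) (Fin n) ℤ} {g : Fin d → ℤ}
    (hne : (integerPoints A g).Nonempty) :
    ∃ p ∈ integerPoints A g, ∀ u : Fin n → ℤ, 0 ≤ u → A *ᵥ u = 0 → u ≤ p → u = 0 := by
  obtain ⟨p, hp, hmin⟩ := (measure fun x : Fin n → ℤ => (∑ j, x j).toNat).wf.has_min _ hne
  refine ⟨p, hp, fun u h1 h2 h3 => ?_⟩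
  have hq : p - u ∈ integerPoints A g :=
    ⟨by rw [Matrix.mulVec_sub, h2, sub_zero, hp.1], sub_nonneg.mpr h3⟩
  have h4 : ¬ (∑ j, (p - u) j).toNat < (∑ j, p j).toNat := hmin _ hq
  have h5 : 0 ≤ ∑ j, (p - u) j := Finset.sum_nonneg fun j _ => hq.2 j
  have h6 : ∑ j, (p - u) j = ∑ j, p j - ∑ j, u j := by simp
  have h7 : 0 ≤ ∑ j, u j := Finset.sum_nonneg fun j _ => h1 j
  have h8 : ∑ j, u j = 0 := by omega
  exact funext fun j => (Finset.sum_eq_zero_iff_of_nonneg fun j _ => h1 j).mp h8 j (Finset.mem_univ j)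

/-- Either all nonnegative integer solutions of `A x = g` lie in an explicit box, or the box
contains `k` of them. -/
theorem integerPoints_subset_or_le_encard {A : Matrix (Fin d) (Fin n) ℤ} {g : Fin d → ℤ} {e : ℕ}
    (hA : ∀ i j, |A i j| ≤ e) (hg : ∀ i, |g i| ≤ e) (k : ℕ) :
    (∀ x ∈ integerPoints A g, ∀ j, x j ≤ boxBound k d n e) ∨
      (k : ℕ∞) ≤ {x ∈ integerPoints A g | ∀ j, x j ≤ boxBound k d n e}.encard := by
  set D := kernelBound d (n + 1) e with hD
  have hB : boxBound k d n e = (n + 1) * D + k * D := by rw [boxBound, ← hD]; ring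
  -- A recession direction `u` may be replaced by a bounded one. Passing through `[A | -g]` with
  -- last entry `0` yields the same bound `D` as for minimal solutions.
  by_cases hker : ∃ u : Fin n → ℤ, u ≠ 0 ∧ 0 ≤ u ∧ A *ᵥ u = 0
  · obtain ⟨u, u0, hu, hAu⟩ := hker
    obtain ⟨v, v0, hv, hAv, hvn, hvb⟩ := exists_bounded_int_kernel_vector (homogenize A g)
      (abs_homogenize_le hA hg) (fun j => j.elim 0 fun j => (u j : ℝ))
      (fun h => u0 (funext fun j => by simpa using congrFun h (some j)))
      (fun j => by
        cases j with
        | none => simp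
        | some j => simpa using hu j)
      (by
        rw [homogenize_mulVec_real, map_mulVec_cast, hAu]
        ext i
        simp)
    have hvn : v none = 0 := hvn none (by simp)
    rw [homogenize_mulVec, hvn, zero_smul, sub_zero] at hAv
    set w : Fin n → ℤ := fun j => v (some j)
    have hwb : ∀ j, w j ≤ D := fun j => by simpa using hvb (some j)
    obtain ⟨j0, hj0⟩ : ∃ j, w j ≠ 0 := by
      by_contra h
      push Not at h
      exact v0 (funext fun j => by
        cases j with
        | none => exact hvn
        | some j => exact h j)
    by_cases hne : (integerPoints A g).Nonempty
    · right
      -- The points `p + t w` with `t < k` are distinct solutions; `p` contributes at most `(n + 1)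
      -- * D` per coordinate and `t w` at most `k * D`.
      obtain ⟨p, hp, hpmin⟩ := exists_sum_minimal_solution hne
      have hpb := le_of_minimal_solution hA hg hp hpmin
      have hinj : Set.InjOn (fun t : ℕ => p + (t : ℤ) • w) (Finset.range k : Set ℕ) := by
        intro s _ t _ hst
        have := congrFun hst j0
        simp only [Pi.add_apply, Pi.smul_apply, smul_eq_mul, add_right_inj] at this
        exact_mod_cast mul_right_cancel₀ hj0 this
      have := Set.encard_le_encard_of_injOn (s := (Finset.range k : Set ℕ))
        (t := {x ∈ integerPoints A g | ∀ j, x j ≤ boxBound k d n e}) (f := fun t : ℕ => p + (t : ℤ) • w)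
        (fun t ht => ⟨⟨by
            rw [Matrix.mulVec_add, Matrix.mulVec_smul, hAv, smul_zero, add_zero, hp.1],
          fun j => by
            have := hp.2 j
            have := mul_nonneg (Int.natCast_nonneg t) (hv (some j))
            simp only [Pi.zero_apply, Pi.add_apply, Pi.smul_apply, smul_eq_mul] at *
            exact add_nonneg ‹_› ‹_›⟩, fun j => by
            have ht' : (t : ℤ) ≤ k := by
              have := Finset.mem_range.mp ht
              omega
            have h1 := hpb j
            have h2 : (t : ℤ) * w j ≤ k * D :=
              mul_le_mul ht' (hwb j) (hv (some j)) (Int.natCast_nonneg k)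
            rw [hB]
            push_cast at h1 ⊢
            exact add_le_add h1 h2⟩) hinj
      rwa [Set.encard_coe_eq_coe_finsetCard, Finset.card_range] at this
    · left
      exact fun x hx => (hne ⟨x, hx⟩).elim
  · push Not at hker
    left
    intro x hx j
    -- Without recession directions every solution is minimal.
    refine (le_of_minimal_solution hA hg hx (fun u h1 h2 _ => ?_) j).trans ?_
    · by_contra h
      exact hker u h h1 h2
    · rw [hB]
      push_cast
      nlinarith [mul_nonneg (Int.natCast_nonneg k) (Int.natCast_nonneg D)]

end Solutions

/-! ### Monomial ideals, separating levels and the cone -/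

section Regions

variable {d n : ℕ}

/-- The integer solutions of `A z = g` that are nonnegative outside `s`. -/
def signedPoints (A : Matrix (Fin d) (Fin n) ℤ) (s : Set (Fin n)) (g : Fin d → ℤ) :
    Set (Fin n → ℤ) :=
  {z | A *ᵥ z = g ∧ ∀ j, j ∉ s → 0 ≤ z j}

theorem signedPoints_empty (A : Matrix (Fin d) (Fin n) ℤ) (g : Fin d → ℤ) :
    signedPoints A ∅ g = integerPoints A g := by
  ext z
  simp [signedPoints, integerPoints, Pi.le_def]

/-- Up to `k`, the points of `signedPoints A s g` can be counted inside an explicit box. -/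
theorem le_encard_signedPoints_iff {A : Matrix (Fin d) (Fin n) ℤ} {g : Fin d → ℤ} {e : ℕ}
    (hA : ∀ i j, |A i j| ≤ e) (hg : ∀ i, |g i| ≤ e) (s : Set (Fin n)) (k : ℕ) :
    (k : ℕ∞) ≤ (signedPoints A s g).encard ↔
      (k : ℕ∞) ≤ {z : Fin n → ℤ | (∀ j, |z j| ≤ boxBound k d n e) ∧
        z ∈ signedPoints A s g}.encard := by
  refine ⟨fun h => ?_, fun h => h.trans (Set.encard_le_encard fun z hz => hz.2)⟩
  by_cases hbd : ∀ z ∈ signedPoints A s g, ∀ j, |z j| ≤ boxBound k d n e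
  · exact h.trans (Set.encard_le_encard fun z hz => ⟨hbd z hz, hz⟩)
  push Not at hbd
  obtain ⟨z, hz, j0, hj0⟩ := hbd
  -- Reflect the orthant of the far point `z` onto the nonnegative one. The reflected system has a
  -- solution outside the box, hence `k` solutions inside it; coordinates outside `s` are not
  -- reflected, so these come from signed points.
  let ε : Fin n → ℤ := fun j => if z j < 0 then -1 else 1
  have hε : ∀ j, ε j * ε j = 1 := fun j => by
    by_cases h : z j < 0 <;> simp [ε, h]
  have hεabs : ∀ j, |ε j| = 1 := fun j => by
    by_cases h : z j < 0 <;> simp [ε, h]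
  have hεz : ∀ j, ε j * z j = |z j| := fun j => by
    by_cases h : z j < 0
    · simp [ε, h, abs_of_neg]
    · simp [ε, h, abs_of_nonneg (not_lt.mp h)]
  let A' : Matrix (Fin d) (Fin n) ℤ := fun i j => A i j * ε j
  have hmul : ∀ x : Fin n → ℤ, A *ᵥ (fun j => ε j * x j) = A' *ᵥ x := fun x => by
    ext i
    simp [Matrix.mulVec, dotProduct, A', mul_assoc]
  have hzz : (fun j => ε j * |z j|) = z := by
    ext j
    rw [← hεz, ← mul_assoc, hε, one_mul]
  have hx : (fun j => |z j|) ∈ integerPoints A' g :=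
    ⟨by rw [← hmul, hzz, hz.1], fun j => abs_nonneg _⟩
  rcases integerPoints_subset_or_le_encard (A := A') (g := g) (e := e)
    (fun i j => by simpa [A', abs_mul, hεabs] using hA i j) hg k with h1 | h1
  · exact absurd (h1 _ hx j0) (not_le.mpr hj0)
  · refine h1.trans (Set.encard_le_encard_of_injOn (f := fun x j => ε j * x j) ?_ ?_)
    · rintro x ⟨hxA, hxb⟩
      refine ⟨fun j => ?_, ?_, fun j hj => ?_⟩
      · simpa [abs_mul, hεabs, abs_of_nonneg (hxA.2 j)] using hxb j
      · rw [hmul, hxA.1]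
      · have : ε j = 1 := by simp [ε, hz.2 j hj]
        simpa [this] using hxA.2 j
    · intro x _ y _ hxy
      ext j
      have h2 := congrArg (ε j * ·) (congrFun hxy j)
      simpa [← mul_assoc, hε] using h2

/-- Translation by `-y` can only destroy nonnegativity in `s`, where it is not demanded. The bound
is uniform in `y`, so one count settles a whole region. -/
theorem encard_integerPoints_add_lt {A : Matrix (Fin d) (Fin n) ℤ} {g : Fin d → ℤ}
    {s : Set (Fin n)} {k : ℕ} (h : (signedPoints A s g).encard < k) {y : Fin n → ℤ}
    (hys : ∀ j, j ∉ s → y j = 0) :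
    (integerPoints A (g + A *ᵥ y)).encard < k := by
  refine lt_of_le_of_lt (Set.encard_le_encard_of_injOn (f := fun x => x - y) ?_ ?_) h
  · rintro x ⟨hx, hx0⟩
    exact ⟨by rw [Matrix.mulVec_sub, hx, add_sub_cancel_right], fun j hj => by
      simpa [hys j hj] using hx0 j⟩
  · intro x _ x' _ hxx
    exact sub_left_injective hxx

theorem encard_integerPoints_le_add (A : Matrix (Fin d) (Fin n) ℤ) (b : Fin d → ℤ)
    {y : Fin n → ℤ} (hy : 0 ≤ y) :
    (integerPoints A b).encard ≤ (integerPoints A (b + A *ᵥ y)).encard := by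
  refine Set.encard_le_encard_of_injOn (f := fun x => x + y) ?_ ?_
  · rintro x ⟨hx, hx0⟩
    exact ⟨by rw [Matrix.mulVec_add, hx], add_nonneg hx0 hy⟩
  · intro x _ x' _ hxx
    exact add_left_injective y hxx

/-- Only `k` signed points are needed, and their negative coordinates, all in `s`, can be lifted by
one common `y`. -/
theorem exists_le_encard_integerPoints_add {A : Matrix (Fin d) (Fin n) ℤ} {g : Fin d → ℤ}
    {s : Set (Fin n)} {k : ℕ} (h : (k : ℕ∞) ≤ (signedPoints A s g).encard) :
    ∃ y : Fin n → ℤ, 0 ≤ y ∧ (∀ j, j ∉ s → y j = 0) ∧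
      (k : ℕ∞) ≤ (integerPoints A (g + A *ᵥ y)).encard := by
  classical
  obtain ⟨t, hts, htk⟩ := Set.exists_subset_encard_eq h
  have hfin : t.Finite := Set.finite_of_encard_eq_coe htk
  let y : Fin n → ℤ := fun j => if j ∈ s then ∑ z ∈ hfin.toFinset, |z j| else 0
  have hy : 0 ≤ y := fun j => by
    simp only [y, Pi.zero_apply]
    split_ifs
    · exact Finset.sum_nonneg fun _ _ => abs_nonneg _
    · exact le_rfl
  refine ⟨y, hy, fun j hj => by simp [y, hj], ?_⟩
  rw [← htk]
  refine Set.encard_le_encard_of_injOn (f := fun x => x + y) ?_ ?_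
  · intro z hz
    refine ⟨by rw [Matrix.mulVec_add, (hts hz).1], fun j => ?_⟩
    by_cases hj : j ∈ s
    · have h1 : |z j| ≤ ∑ z ∈ hfin.toFinset, |z j| :=
        Finset.single_le_sum (f := fun z : Fin n → ℤ => |z j|) (fun _ _ => abs_nonneg _)
          (hfin.mem_toFinset.mpr hz)
      have h2 := neg_abs_le (z j)
      simp only [Pi.zero_apply, Pi.add_apply, y, hj, if_true]
      linarith
    · simpa [y, hj] using (hts hz).2 j hj
  · intro x _ x' _ hxx
    exact add_left_injective y hxx

/-- Dickson's lemma in truncated form. -/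
theorem exists_truncation_mem {J : Set (Fin n → ℕ)} (hJ : IsUpperSet J) :
    ∃ T0 : ℕ, ∀ T ≥ T0, ∀ x ∈ J, (fun j => min (x j) T) ∈ J := by
  have hfin : {x | Minimal (· ∈ J) x}.Finite :=
    (setOfPred_minimal_antichain _).finite_of_partiallyWellOrderedOn
      (Set.isPWO_of_wellQuasiOrderedLE _)
  -- Any level above all coordinates of the finitely many minimal elements works: then `m ≤ x`
  -- implies `m ≤ min x T`.
  refine ⟨∑ m ∈ hfin.toFinset, ∑ j, m j, fun T hT x hx => ?_⟩
  obtain ⟨m, hmx, hm⟩ := exists_minimal_le_of_wellFoundedLT (· ∈ J) x hx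
  refine hJ (fun j => le_min (hmx j) (le_trans ?_ hT)) hm.prop
  exact (Finset.single_le_sum (f := m) (fun _ _ => Nat.zero_le _) (Finset.mem_univ j)).trans
    (Finset.single_le_sum (f := fun m : Fin n → ℕ => ∑ j, m j) (fun _ _ => Nat.zero_le _)
      (hfin.mem_toFinset.mpr hm))

/-- At level `T` every region `p + ℕ^s` with `0 ≤ p ≤ T` and `s = {j | p j = T}` either starts in
the monomial ideal belonging to some `f ∈ F`, or misses it. -/
def IsSeparating (k : ℕ) (A : Matrix (Fin d) (Fin n) ℤ) (F : Set (Fin d → ℤ)) (T : ℕ) : Prop :=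
  ∀ f ∈ F, ∀ p : Fin n → ℤ, 0 ≤ p → (∀ j, p j ≤ T) →
    (k : ℕ∞) ≤ (integerPoints A (f + A *ᵥ p)).encard ∨
      (signedPoints A {j | p j = T} (f + A *ᵥ p)).encard < k

/-- Suppose the region of `p` meets the ideal of `f` in `p + y`. As `y` only changes coordinates
that already equal `T`, truncating `p + y` at `T` gives back `p`, which is therefore in the ideal
once `T` exceeds the truncation level of `f`. Summing these levels serves all `f` at once. -/
theorem exists_isSeparating (k : ℕ) (A : Matrix (Fin d) (Fin n) ℤ) {F : Set (Fin d → ℤ)}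
    (hF : F.Finite) : ∃ T, IsSeparating k A F T := by
  have key : ∀ f : Fin d → ℤ, ∃ T0 : ℕ, ∀ T ≥ T0, ∀ x : Fin n → ℕ,
      (k : ℕ∞) ≤ (integerPoints A (f + A *ᵥ fun j => (x j : ℤ))).encard →
      (k : ℕ∞) ≤ (integerPoints A (f + A *ᵥ fun j => ((min (x j) T : ℕ) : ℤ))).encard := by
    intro f
    refine exists_truncation_mem
      (J := {x | (k : ℕ∞) ≤ (integerPoints A (f + A *ᵥ fun j => (x j : ℤ))).encard}) ?_
    intro x x' hxx hx
    have h1 := encard_integerPoints_le_add A (f + A *ᵥ fun j => (x j : ℤ))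
      (y := fun j => (x' j : ℤ) - x j) (fun j => sub_nonneg.mpr (Int.ofNat_le.mpr (hxx j)))
    have h2 : (fun j => (x j : ℤ)) + (fun j => (x' j : ℤ) - x j) = fun j => (x' j : ℤ) := by
      ext j
      simp
    rw [add_assoc, ← Matrix.mulVec_add, h2] at h1
    exact le_trans hx h1
  choose T0 hT0 using key
  refine ⟨∑ f ∈ hF.toFinset, T0 f, fun f hf p hp hpT => ?_⟩
  set T := ∑ f ∈ hF.toFinset, T0 f with hT
  rw [← not_le, or_iff_not_imp_right, not_not]
  intro h
  obtain ⟨y, hy, hys, hk⟩ := exists_le_encard_integerPoints_add h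
  have hTf : T ≥ T0 f := Finset.single_le_sum (f := T0) (fun _ _ => Nat.zero_le _)
    (hF.mem_toFinset.mpr hf)
  have h1 : (fun j => (((p + y) j).toNat : ℤ)) = p + y := by
    ext j
    exact Int.toNat_of_nonneg (add_nonneg (hp j) (hy j))
  have h2 := hT0 f T hTf (fun j => ((p + y) j).toNat)
    (by rwa [h1, Matrix.mulVec_add, ← add_assoc])
  have h3 : (fun j => ((min ((p + y) j).toNat T : ℕ) : ℤ)) = p := by
    ext j
    have h4 := hp j
    have h5 := hpT j
    have h6 := hy j
    have h7 : p j = T ∨ y j = 0 := or_iff_not_imp_left.mpr fun h => hys j h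
    simp only [Pi.zero_apply, Pi.add_apply] at *
    omega
  rwa [h3] at h2

theorem mem_cone_add {A : Matrix (Fin d) (Fin n) ℤ} {f : Fin d → ℤ}
    (hf : (fun i => (f i : ℝ)) ∈ cone A) {x : Fin n → ℤ} (hx : 0 ≤ x) :
    (fun i => ((f + A *ᵥ x) i : ℝ)) ∈ cone A := by
  obtain ⟨c, hc, hcf⟩ := hf
  refine ⟨fun j => c j + x j, fun j => add_nonneg (hc j) (Int.cast_nonneg (hx j)), ?_⟩
  have : (fun j => c j + (x j : ℝ)) = c + fun j => (x j : ℝ) := rfl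
  rw [this, Matrix.mulVec_add, hcf, map_mulVec_cast]
  ext i
  simp

/-- Each `x` lies in the region starting at `p = min x T`, and separation rules out that the region
of a `k`-hole meets the ideal. -/
theorem mem_kHoles_iff_of_isSeparating {k : ℕ} {A : Matrix (Fin d) (Fin n) ℤ}
    {F : Set (Fin d → ℤ)} {T : ℕ} (hT : IsSeparating k A F T)
    (hF : ∀ f ∈ F, (fun i => (f i : ℝ)) ∈ cone A)
    (hcov : ∀ b : Fin d → ℤ, (fun i => (b i : ℝ)) ∈ cone A →
      ∃ f ∈ F, ∃ x : Fin n → ℤ, 0 ≤ x ∧ b = f + A *ᵥ x) (b : Fin d → ℤ) :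
    b ∈ kHoles k A ↔ ∃ f ∈ F, ∃ p : Fin n → ℤ, 0 ≤ p ∧ (∀ j, p j ≤ T) ∧
      (signedPoints A {j | p j = T} (f + A *ᵥ p)).encard < k ∧
      ∃ y : Fin n → ℤ, 0 ≤ y ∧ (∀ j, p j ≠ T → y j = 0) ∧ b = f + A *ᵥ p + A *ᵥ y := by
  constructor
  · rintro ⟨hb, hbk⟩
    obtain ⟨f, hf, x, hx, rfl⟩ := hcov b hb
    let p : Fin n → ℤ := fun j => min (x j) T
    have hp : 0 ≤ p := fun j => le_min (hx j) (Int.natCast_nonneg T)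
    have hpx : p ≤ x := fun j => min_le_left _ _
    have hb' : f + A *ᵥ x = f + A *ᵥ p + A *ᵥ (x - p) := by
      rw [add_assoc, ← Matrix.mulVec_add, add_sub_cancel]
    have hpT : ∀ j, p j ≤ T := fun j => min_le_right _ _
    refine ⟨f, hf, p, hp, hpT, ?_, x - p, sub_nonneg.mpr hpx, fun j hj => ?_, hb'⟩
    · refine (hT f hf p hp hpT).resolve_left fun h => absurd hbk (not_lt.mpr ?_)
      rw [hb']
      exact h.trans (encard_integerPoints_le_add A _ (sub_nonneg.mpr hpx))
    · simp only [p, Pi.sub_apply] at hj ⊢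
      omega
  · rintro ⟨f, hf, p, hp, hpT, hk, y, hy, hys, rfl⟩
    refine ⟨?_, encard_integerPoints_add_lt hk hys⟩
    have := mem_cone_add (hF f hf) (add_nonneg hp hy)
    rwa [Matrix.mulVec_add, ← add_assoc] at this

theorem mem_translatedSemigroup_columns (A : Matrix (Fin d) (Fin n) ℤ) (h b : Fin d → ℤ)
    {s : Set (Fin n)} {gens : List (Fin d → ℤ)}
    (hgens : ∀ v, v ∈ gens ↔ ∃ j ∈ s, v = fun i => A i j) :
    b ∈ translatedSemigroup h gens ↔
      ∃ y : Fin n → ℤ, 0 ≤ y ∧ (∀ j, j ∉ s → y j = 0) ∧ b = h + A *ᵥ y := by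
  classical
  constructor
  · rintro ⟨m, hm, rfl⟩
    suffices ∃ y : Fin n → ℤ, 0 ≤ y ∧ (∀ j, j ∉ s → y j = 0) ∧ m = A *ᵥ y by
      obtain ⟨y, h1, h2, rfl⟩ := this
      exact ⟨y, h1, h2, rfl⟩
    induction hm using AddSubmonoid.closure_induction with
    | mem v hv =>
      obtain ⟨j, hj, rfl⟩ := (hgens v).mp hv
      refine ⟨Pi.single j 1, Pi.single_nonneg.mpr zero_le_one, fun j' hj' => ?_, ?_⟩
      · exact Pi.single_eq_of_ne (by rintro rfl; exact hj' hj) _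
      · ext i
        simp
    | zero => exact ⟨0, le_rfl, fun _ _ => rfl, by simp⟩
    | add v w _ _ hv hw =>
      obtain ⟨y, h1, h2, rfl⟩ := hv
      obtain ⟨y', h1', h2', rfl⟩ := hw
      exact ⟨y + y', add_nonneg h1 h1', fun j hj => by simp [h2 j hj, h2' j hj],
        by rw [Matrix.mulVec_add]⟩
  · rintro ⟨y, hy, hys, rfl⟩
    refine ⟨A *ᵥ y, ?_, rfl⟩
    have : A *ᵥ y = ∑ j, (y j).toNat • (fun i => A i j : Fin d → ℤ) := by
      ext i
      simp only [Matrix.mulVec, dotProduct, Finset.sum_apply]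
      refine Finset.sum_congr rfl fun j _ => ?_
      change A i j * y j = (y j).toNat • A i j
      rw [nsmul_eq_mul, Int.toNat_of_nonneg (hy j), mul_comm]
    rw [this]
    refine AddSubmonoid.sum_mem _ fun j _ => ?_
    by_cases hj : j ∈ s
    · have hmem : (fun i => A i j) ∈ {g : Fin d → ℤ | g ∈ gens} := (hgens _).mpr ⟨j, hj, rfl⟩
      exact AddSubmonoid.nsmul_mem _ (AddSubmonoid.subset_closure hmem) _
    · simp [hys j hj]

/-- A real representation of `f` is a kernel vector of `[A | -f]` with last entry `1`; a bounded
integer one with positive last entry exhibits a multiple of `f` as a nonnegative integer combination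
of columns. That multiplier is written `t + 1` to keep it positive. -/
theorem mem_cone_iff {A : Matrix (Fin d) (Fin n) ℤ} {f : Fin d → ℤ} {e : ℕ}
    (hA : ∀ i j, |A i j| ≤ e) (hf : ∀ i, |f i| ≤ e) :
    (fun i => (f i : ℝ)) ∈ cone A ↔
      ∃ x : Fin n → ℤ, (∀ j, |x j| ≤ kernelBound d (n + 1) e) ∧ 0 ≤ x ∧
        ∃ t : ℕ, t < kernelBound d (n + 1) e ∧ ∀ i, (A *ᵥ x) i = (t + 1) * f i := by
  constructor
  · rintro ⟨c, hc, hcf⟩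
    obtain ⟨u, h1, h2, h3, h4⟩ := exists_bounded_int_kernel_vector_pos (homogenize A f)
      (abs_homogenize_le hA hf) none (fun j => j.elim 1 c)
      (fun j => by
        cases j with
        | none => simp
        | some j => simpa using hc j)
      (by rw [homogenize_mulVec_real, hcf, one_smul, sub_self]) (by simp)
    simp only [Fintype.card_fin, Fintype.card_option] at h4
    rw [homogenize_mulVec] at h3
    refine ⟨fun j => u (some j), fun j => ?_, fun j => h2 _, (u none - 1).toNat, ?_, fun i => ?_⟩
    · rw [abs_of_nonneg (h2 (some j))]
      exact h4 _
    · have := h4 none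
      omega
    · have h5 : (((u none - 1).toNat : ℤ) + 1) = u none := by omega
      rw [h5, sub_eq_zero.mp h3]
      rfl
  · rintro ⟨x, -, hx, t, -, h⟩
    have ht : (0 : ℝ) < t + 1 := by positivity
    refine ⟨(t + 1 : ℝ)⁻¹ • fun j => (x j : ℝ), fun j => ?_, ?_⟩
    · exact mul_nonneg (inv_nonneg.mpr ht.le) (Int.cast_nonneg (hx j))
    · rw [Matrix.mulVec_smul, map_mulVec_cast]
      ext i
      simp only [Pi.smul_apply, smul_eq_mul, h]
      push_cast
      field_simp

theorem abs_le_sum_abs (A : Matrix (Fin d) (Fin n) ℤ) (i : Fin d) (j : Fin n) :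
    |A i j| ≤ ∑ i, ∑ j, |A i j| :=
  (Finset.single_le_sum (f := fun j => |A i j|) (fun _ _ => abs_nonneg _)
    (Finset.mem_univ j)).trans
  (Finset.single_le_sum (f := fun i => ∑ j, |A i j|)
    (fun _ _ => Finset.sum_nonneg fun _ _ => abs_nonneg _) (Finset.mem_univ i))

/-- Every integer point of the cone is a sum of one in the zonotope of the columns and a
nonnegative integer combination of the columns. -/
theorem exists_zonotope_add (A : Matrix (Fin d) (Fin n) ℤ) {b : Fin d → ℤ}
    (hb : (fun i => (b i : ℝ)) ∈ cone A) :
    ∃ f : Fin d → ℤ, (∀ i, |f i| ≤ ∑ i, ∑ j, |A i j|) ∧ (fun i => (f i : ℝ)) ∈ cone A ∧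
      ∃ x : Fin n → ℤ, 0 ≤ x ∧ b = f + A *ᵥ x := by
  obtain ⟨c, hc, hcb⟩ := hb
  -- The integral parts give the column combination; the fractional parts, all below `1`, leave a
  -- point of the zonotope.
  let x : Fin n → ℤ := fun j => ⌊c j⌋
  have hf : (A.map fun a : ℤ => (a : ℝ)) *ᵥ (fun j => Int.fract (c j)) =
      fun i => ((b - A *ᵥ x) i : ℝ) := by
    have : (fun j => Int.fract (c j)) = c - fun j => (x j : ℝ) := rfl
    rw [this, Matrix.mulVec_sub, hcb, map_mulVec_cast]
    ext i
    simp
  refine ⟨b - A *ᵥ x, fun i => ?_, ⟨_, fun j => Int.fract_nonneg _, hf⟩, x,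
    fun j => Int.floor_nonneg.mpr (hc j), by simp⟩
  have h1 : |(b - A *ᵥ x) i| ≤ ∑ j, |A i j| := by
    have h2 := congrFun hf i
    have h3 : |(((b - A *ᵥ x) i : ℤ) : ℝ)| ≤ ∑ j, |(A i j : ℝ)| := by
      rw [← h2]
      simp only [Matrix.mulVec, dotProduct, Matrix.map_apply]
      refine (Finset.abs_sum_le_sum_abs _ _).trans (Finset.sum_le_sum fun j _ => ?_)
      rw [abs_mul, abs_of_nonneg (Int.fract_nonneg (c j))]
      exact mul_le_of_le_one_right (abs_nonneg _) (Int.fract_lt_one _).le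
    exact_mod_cast h3
  exact h1.trans (Finset.single_le_sum (f := fun i => ∑ j, |A i j|)
    (fun _ _ => Finset.sum_nonneg fun _ _ => abs_nonneg _) (Finset.mem_univ i))

end Regions

/-! ### Vectors and matrices as lists -/

section Lists

/-- The vector of length `n` read off from a list, padded with zeros. -/
def toVec (n : ℕ) (l : List ℤ) : Fin n → ℤ := fun j => l.getD j 0

/-- The `(i, j)` entry of a list of rows, padded with zeros. -/
def entry (A : List (List ℤ)) (i j : ℕ) : ℤ := (A.getD i []).getD j 0

/-- The `d × n` matrix read off from a list of rows. -/
def toMat (d n : ℕ) (A : List (List ℤ)) : Matrix (Fin d) (Fin n) ℤ := fun i j => entry A i j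

/-- The `i`-th entry of the product of a matrix having `n` columns with a vector. -/
def mulEntry (n : ℕ) (A : List (List ℤ)) (x : List ℤ) (i : ℕ) : ℤ :=
  ∑ j ∈ Finset.range n, entry A i j * x.getD j 0

/-- All lists of length `n` with entries in `[-C, C]`. -/
def box (C : ℕ) : ℕ → List (List ℤ)
  | 0 => [[]]
  | n + 1 => (box C n).flatMap fun l =>
      (List.range (2 * C + 1)).map fun i : ℕ => ((i : ℤ) - C) :: l

theorem vecCode_toVec {n : ℕ} {l : List ℤ} (hl : l.length = n) : vecCode (toVec n l) = l := by
  subst hl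
  refine List.ext_getElem (by simp [vecCode]) fun i h1 h2 => ?_
  simp [vecCode, toVec, h2]

theorem toVec_vecCode {n : ℕ} (v : Fin n → ℤ) : toVec n (vecCode v) = v := by
  ext j
  simp [vecCode, toVec]

theorem toMat_matrixCode {d n : ℕ} (A : Matrix (Fin d) (Fin n) ℤ) :
    toMat d n (matrixCode A) = A := by
  ext i j
  simp [matrixCode, vecCode, toMat, entry]

theorem mulEntry_eq {d n : ℕ} (A : List (List ℤ)) (x : List ℤ) (i : Fin d) :
    mulEntry n A x i = (toMat d n A *ᵥ toVec n x) i := by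
  simp [mulEntry, Finset.sum_range, Matrix.mulVec, dotProduct, toMat, toVec]

theorem mem_box {C n : ℕ} {l : List ℤ} :
    l ∈ box C n ↔ l.length = n ∧ ∀ j, |toVec n l j| ≤ C := by
  induction n generalizing l with
  | zero => simp [box]
  | succ n ih =>
    simp only [box, List.mem_flatMap, List.mem_map, List.mem_range]
    constructor
    · rintro ⟨l', hl', i, hi, rfl⟩
      obtain ⟨h1, h2⟩ := ih.mp hl'
      refine ⟨by simp [h1], Fin.cases ?_ fun j => h2 j⟩
      simp only [toVec, Fin.val_zero, List.getD_cons_zero]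
      rw [abs_le]
      omega
    · rintro ⟨h1, h2⟩
      cases l with
      | nil => simp at h1
      | cons a l =>
        have ha : |a| ≤ C := h2 0
        rw [abs_le] at ha
        exact ⟨l, ih.mpr ⟨by simpa using h1, fun j => h2 j.succ⟩, (a + C).toNat, by omega,
          by congr 1; omega⟩

theorem nodup_box (C n : ℕ) : (box C n).Nodup := by
  induction n with
  | zero => simp [box]
  | succ n ih =>
    rw [box, List.nodup_flatMap]
    refine ⟨fun l _ => List.nodup_range.map fun a b h => by simpa using h, ih.imp ?_⟩
    intro l l' hll
    simp only [Function.onFun, List.disjoint_left, List.mem_map]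
    rintro _ ⟨i, _, rfl⟩ ⟨i', _, h⟩
    exact hll (List.cons.inj h).2.symm

/-- On lists of length `n` decoding is injective, and `box` has no repetitions, so list length is
cardinality. -/
theorem length_filter_box (C n : ℕ) (P : (Fin n → ℤ) → Prop) (Q : List ℤ → Prop)
    [DecidablePred Q] (hPQ : ∀ l ∈ box C n, Q l ↔ P (toVec n l)) :
    (((box C n).filter Q).length : ℕ∞) = {z : Fin n → ℤ | (∀ j, |z j| ≤ C) ∧ P z}.encard := by
  have h1 : {z : Fin n → ℤ | (∀ j, |z j| ≤ C) ∧ P z} =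
      toVec n '' (((box C n).filter Q).toFinset : Set (List ℤ)) := by
    ext z
    simp only [Set.mem_ofPred_eq, Set.mem_image, List.coe_toFinset, List.mem_filter,
      decide_eq_true_eq]
    constructor
    · rintro ⟨h1, h2⟩
      have h3 : vecCode z ∈ box C n := mem_box.mpr ⟨by simp [vecCode], by rwa [toVec_vecCode]⟩
      exact ⟨vecCode z, ⟨h3, (hPQ _ h3).mpr (by rwa [toVec_vecCode])⟩, toVec_vecCode z⟩
    · rintro ⟨l, ⟨h1, h2⟩, rfl⟩
      exact ⟨(mem_box.mp h1).2, (hPQ l h1).mp h2⟩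
  rw [h1, Set.InjOn.encard_image, Set.encard_coe_eq_coe_finsetCard,
    List.toFinset_card_of_nodup ((nodup_box C n).filter _)]
  intro l hl l' hl' h
  simp only [List.coe_toFinset, List.mem_filter, Set.mem_ofPred_eq] at hl hl'
  rw [← vecCode_toVec (mem_box.mp hl.1).1, h, vecCode_toVec (mem_box.mp hl'.1).1]

end Lists

/-! ### The algorithm on lists and its correctness -/

section Algorithm

/-- The input of the algorithm: `k`, the numbers of rows and columns, and the rows. -/
abbrev Input := ℕ × ℕ × ℕ × List (List ℤ)

variable (I : Input)

/-- The matrix of the input. -/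
def Input.matrix : Matrix (Fin I.2.1) (Fin I.2.2.1) ℤ := toMat I.2.1 I.2.2.1 I.2.2.2

/-- The sum of the absolute values of the entries. -/
def absSum : ℕ :=
  ∑ i ∈ Finset.range I.2.1, ∑ j ∈ Finset.range I.2.2.1, (entry I.2.2.2 i j).natAbs

/-- A bound for the entries of the matrix and of the right-hand side `g`. -/
def sizeBound (g : List ℤ) : ℕ := absSum I + ∑ i ∈ Finset.range I.2.1, (g.getD i 0).natAbs

/-- `z` solves `A z = g` and is nonnegative in the coordinates where `p` differs from `T`. -/
def IsSignedPoint (p : List ℤ) (T : ℕ) (g z : List ℤ) : Prop :=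
  (∀ i < I.2.1, mulEntry I.2.2.1 I.2.2.2 z i = g.getD i 0) ∧
    ∀ j < I.2.2.1, p.getD j 0 = T ∨ 0 ≤ z.getD j 0

instance (p : List ℤ) (T : ℕ) (g : List ℤ) : DecidablePred (IsSignedPoint I p T g) := fun _ => by
  unfold IsSignedPoint; infer_instance

/-- The number of solutions as in `IsSignedPoint` within the box of radius `boxBound`. -/
def countSigned (p : List ℤ) (T : ℕ) (g : List ℤ) : ℕ :=
  ((box (boxBound I.1 I.2.1 I.2.2.1 (sizeBound I g)) I.2.2.1).filter
    (IsSignedPoint I p T g)).length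

/-- The test whether the integer vector `f` lies in the cone. -/
def ConeTest (f : List ℤ) : Prop :=
  ∃ x ∈ box (kernelBound I.2.1 (I.2.2.1 + 1) (absSum I)) I.2.2.1, (∀ j < I.2.2.1, 0 ≤ x.getD j 0) ∧
    ∃ t < kernelBound I.2.1 (I.2.2.1 + 1) (absSum I), ∀ i < I.2.1,
      mulEntry I.2.2.1 I.2.2.2 x i = ((t : ℤ) + 1) * f.getD i 0

instance : DecidablePred (ConeTest I) := fun _ => by
  unfold ConeTest; infer_instance

/-- The integer points of the cone in a box that contains the zonotope of the columns. -/
def conePoints : List (List ℤ) := (box (absSum I) I.2.1).filter (ConeTest I)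

/-- The points of `{0, …, T}^n`. -/
def basePoints (T : ℕ) : List (List ℤ) :=
  (box T I.2.2.1).filter fun p => ∀ j < I.2.2.1, 0 ≤ p.getD j 0

/-- The vector `f + A p`. -/
def shift (f p : List ℤ) : List ℤ :=
  (List.range I.2.1).map fun i => f.getD i 0 + mulEntry I.2.2.1 I.2.2.2 p i

/-- The list version of `IsSeparating`. -/
def Separates (T : ℕ) : Prop :=
  ∀ f ∈ conePoints I, ∀ p ∈ basePoints I T,
    -- The empty list reads as `0` everywhere, never equal to the level `1`, so this counts
    -- solutions nonnegative in all coordinates.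
    I.1 ≤ countSigned I [] 1 (shift I f p) ∨ countSigned I p T (shift I f p) < I.1

instance : DecidablePred (Separates I) := fun _ => by
  unfold Separates; infer_instance

/-- The columns of `A` at the positions where `p` equals `T`. -/
def columnsAt (T : ℕ) (p : List ℤ) : List (List ℤ) :=
  ((List.range I.2.2.1).filter fun j => p.getD j 0 = T).map fun j =>
    (List.range I.2.1).map fun i => entry I.2.2.2 i j

/-- The translated semigroups that represent the `k`-holes if `T` separates. -/
def pieces (T : ℕ) : List (List ℤ × List (List ℤ)) :=
  (conePoints I).flatMap fun f =>
    ((basePoints I T).filter fun p => countSigned I p T (shift I f p) < I.1).map fun p =>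
      (shift I f p, columnsAt I T p)

theorem absSum_eq : (absSum I : ℤ) = ∑ i, ∑ j, |I.matrix i j| := by
  simp [absSum, Finset.sum_range, Input.matrix, toMat]

theorem sizeBound_spec (g : List ℤ) :
    (∀ i j, |I.matrix i j| ≤ sizeBound I g) ∧ ∀ i, |toVec I.2.1 g i| ≤ sizeBound I g := by
  have h1 := absSum_eq I
  have h2 : ((∑ i ∈ Finset.range I.2.1, (g.getD i 0).natAbs : ℕ) : ℤ) =
      ∑ i, |toVec I.2.1 g i| := by
    simp [Finset.sum_range, toVec]
  have h3 : ∀ i, |toVec I.2.1 g i| ≤ ∑ i, |toVec I.2.1 g i| := fun i =>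
    Finset.single_le_sum (f := fun i => |toVec I.2.1 g i|) (fun _ _ => abs_nonneg _)
      (Finset.mem_univ i)
  rw [sizeBound, Nat.cast_add, h2]
  refine ⟨fun i j => ?_, fun i => ?_⟩
  · have := abs_le_sum_abs I.matrix i j
    have : 0 ≤ ∑ i, |toVec I.2.1 g i| := Finset.sum_nonneg fun _ _ => abs_nonneg _
    omega
  · have := h3 i
    omega

theorem isSignedPoint_iff (p : List ℤ) (T : ℕ) (g z : List ℤ) :
    IsSignedPoint I p T g z ↔
      toVec _ z ∈ signedPoints I.matrix {j | toVec _ p j = T} (toVec _ g) := by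
  refine and_congr ?_ ?_
  · constructor
    · intro h
      ext i
      rw [Input.matrix, ← mulEntry_eq]
      exact h i i.2
    · intro h i hi
      rw [mulEntry_eq (d := I.2.1) _ _ ⟨i, hi⟩]
      exact congrFun h _
  · constructor
    · exact fun h j hj => (h j j.2).resolve_left hj
    · exact fun h j hj => or_iff_not_imp_left.mpr fun hp => h ⟨j, hj⟩ hp

/-- The box depends on `k`: the count need not be the true number of points, but its comparison with
`k` is correct. -/
theorem le_countSigned_iff (p : List ℤ) (T : ℕ) (g : List ℤ) :
    I.1 ≤ countSigned I p T g ↔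
      (I.1 : ℕ∞) ≤ (signedPoints I.matrix {j | toVec _ p j = T} (toVec _ g)).encard := by
  rw [le_encard_signedPoints_iff (sizeBound_spec I g).1 (sizeBound_spec I g).2,
    ← Nat.cast_le (α := ℕ∞), countSigned,
    length_filter_box _ _ _ _ fun l _ => isSignedPoint_iff I p T g l]

theorem countSigned_lt_iff (p : List ℤ) (T : ℕ) (g : List ℤ) :
    countSigned I p T g < I.1 ↔
      (signedPoints I.matrix {j | toVec _ p j = T} (toVec _ g)).encard < (I.1 : ℕ∞) := by
  rw [← not_le, le_countSigned_iff, not_le]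

theorem le_countSigned_nil_iff (g : List ℤ) :
    I.1 ≤ countSigned I [] 1 g ↔ (I.1 : ℕ∞) ≤ (integerPoints I.matrix (toVec _ g)).encard := by
  rw [le_countSigned_iff, ← signedPoints_empty]
  simp [toVec]

theorem coneTest_iff {f : List ℤ} (hf : ∀ i, |toVec I.2.1 f i| ≤ absSum I) :
    ConeTest I f ↔ (fun i => (toVec I.2.1 f i : ℝ)) ∈ cone I.matrix := by
  rw [mem_cone_iff (e := absSum I) (fun i j => absSum_eq I ▸ abs_le_sum_abs _ _ _) hf]
  have key : ∀ x : List ℤ, ((∀ j < I.2.2.1, 0 ≤ x.getD j 0) ∧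
      ∃ t < kernelBound I.2.1 (I.2.2.1 + 1) (absSum I), ∀ i < I.2.1,
      mulEntry I.2.2.1 I.2.2.2 x i = ((t : ℤ) + 1) * f.getD i 0) ↔ (0 ≤ toVec I.2.2.1 x ∧
        ∃ t : ℕ, t < kernelBound I.2.1 (I.2.2.1 + 1) (absSum I) ∧
          ∀ i, (I.matrix *ᵥ toVec I.2.2.1 x) i = (t + 1) * toVec I.2.1 f i) := by
    intro x
    refine and_congr ⟨fun h j => h j j.2, fun h j hj => h ⟨j, hj⟩⟩ ?_
    refine exists_congr fun t => and_congr Iff.rfl ?_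
    constructor
    · intro h i
      rw [Input.matrix, ← mulEntry_eq]
      exact h i i.2
    · intro h i hi
      rw [mulEntry_eq (d := I.2.1) _ _ ⟨i, hi⟩]
      exact h _
  constructor
  · rintro ⟨x, hx, h⟩
    exact ⟨toVec _ x, (mem_box.mp hx).2, (key x).mp h⟩
  · rintro ⟨x, hx, h⟩
    refine ⟨vecCode x, mem_box.mpr ⟨by simp [vecCode], by rwa [toVec_vecCode]⟩, (key _).mpr ?_⟩
    rwa [toVec_vecCode]

theorem mem_conePoints {f : List ℤ} :
    f ∈ conePoints I ↔ f.length = I.2.1 ∧ (∀ i, |toVec I.2.1 f i| ≤ absSum I) ∧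
      (fun i => (toVec I.2.1 f i : ℝ)) ∈ cone I.matrix := by
  rw [conePoints, List.mem_filter, mem_box, decide_eq_true_eq, and_assoc]
  exact and_congr_right fun _ => and_congr_right fun h => coneTest_iff I h

theorem mem_basePoints {T : ℕ} {p : List ℤ} :
    p ∈ basePoints I T ↔ p.length = I.2.2.1 ∧ 0 ≤ toVec I.2.2.1 p ∧
      ∀ j, toVec I.2.2.1 p j ≤ T := by
  rw [basePoints, List.mem_filter, mem_box, decide_eq_true_eq, and_assoc]
  refine and_congr_right fun _ => ?_
  constructor
  · exact fun ⟨h1, h2⟩ => ⟨fun j => h2 j j.2, fun j => (abs_le.mp (h1 j)).2⟩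
  · exact fun ⟨h1, h2⟩ => ⟨fun j => by rw [abs_of_nonneg (h1 j)]; exact h2 j,
      fun j hj => h1 ⟨j, hj⟩⟩

theorem toVec_map_range {d : ℕ} (h : ℕ → ℤ) :
    toVec d ((List.range d).map h) = fun i : Fin d => h i := by
  ext i
  simp [toVec]

theorem toVec_shift (f p : List ℤ) :
    toVec I.2.1 (shift I f p) = toVec I.2.1 f + I.matrix *ᵥ toVec I.2.2.1 p := by
  rw [shift, toVec_map_range]
  ext i
  rw [mulEntry_eq]
  rfl

/-- The vectors represented by `conePoints`. -/
def conePointSet : Set (Fin I.2.1 → ℤ) :=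
  {f | (∀ i, |f i| ≤ absSum I) ∧ (fun i => (f i : ℝ)) ∈ cone I.matrix}

theorem finite_conePointSet : (conePointSet I).Finite := by
  refine (Set.finite_Icc (fun _ => -(absSum I : ℤ)) fun _ => (absSum I : ℤ)).subset fun f hf => ?_
  exact ⟨fun i => (abs_le.mp (hf.1 i)).1, fun i => (abs_le.mp (hf.1 i)).2⟩

theorem exists_conePoints_iff (P : (Fin I.2.1 → ℤ) → Prop) :
    (∃ f ∈ conePoints I, P (toVec _ f)) ↔ ∃ f ∈ conePointSet I, P f := by
  constructor
  · exact fun ⟨f, hf, h⟩ => ⟨_, ((mem_conePoints I).mp hf).2, h⟩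
  · rintro ⟨f, hf, h⟩
    refine ⟨vecCode f, (mem_conePoints I).mpr ⟨by simp [vecCode], ?_⟩, by rwa [toVec_vecCode]⟩
    rwa [toVec_vecCode]

theorem exists_basePoints_iff (T : ℕ) (P : (Fin I.2.2.1 → ℤ) → Prop) :
    (∃ p ∈ basePoints I T, P (toVec _ p)) ↔
      ∃ p : Fin I.2.2.1 → ℤ, 0 ≤ p ∧ (∀ j, p j ≤ T) ∧ P p := by
  constructor
  · rintro ⟨p, hp, h⟩
    obtain ⟨-, h1, h2⟩ := (mem_basePoints I).mp hp
    exact ⟨_, h1, h2, h⟩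
  · rintro ⟨p, h1, h2, h⟩
    refine ⟨vecCode p, (mem_basePoints I).mpr ⟨by simp [vecCode], ?_⟩, by rwa [toVec_vecCode]⟩
    rw [toVec_vecCode]
    exact ⟨h1, h2⟩

theorem separates_iff (T : ℕ) :
    Separates I T ↔ IsSeparating I.1 I.matrix (conePointSet I) T := by
  constructor
  · intro h f hf p hp hpT
    have h1 : vecCode f ∈ conePoints I := (mem_conePoints I).mpr
      ⟨by simp [vecCode], by rw [toVec_vecCode]; exact hf⟩
    have h2 : vecCode p ∈ basePoints I T := (mem_basePoints I).mpr
      ⟨by simp [vecCode], by rw [toVec_vecCode]; exact ⟨hp, hpT⟩⟩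
    simpa only [le_countSigned_nil_iff, countSigned_lt_iff, toVec_shift, toVec_vecCode] using
      h _ h1 _ h2
  · intro h f hf p hp
    obtain ⟨-, h1, h2⟩ := (mem_basePoints I).mp hp
    simpa only [le_countSigned_nil_iff, countSigned_lt_iff, toVec_shift] using
      h _ ((mem_conePoints I).mp hf).2 _ h1 h2

theorem exists_separates : ∃ T, Separates I T := by
  simp only [separates_iff]
  exact exists_isSeparating _ _ (finite_conePointSet I)

theorem mem_columnsAt (T : ℕ) (p : List ℤ) (v : Fin I.2.1 → ℤ) :
    v ∈ (columnsAt I T p).map (toVec I.2.1) ↔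
      ∃ j ∈ {j | toVec I.2.2.1 p j = T}, v = fun i => I.matrix i j := by
  simp only [columnsAt, List.map_map, List.mem_map, List.mem_filter, List.mem_range,
    Function.comp, toVec_map_range, decide_eq_true_eq, Set.mem_ofPred_eq]
  constructor
  · rintro ⟨j, ⟨hj, h⟩, rfl⟩
    exact ⟨⟨j, hj⟩, h, rfl⟩
  · rintro ⟨j, h, rfl⟩
    exact ⟨j, ⟨j.2, h⟩, rfl⟩

/-- The output of `pieces` as a family of vectors. -/
def decodedPieces (T : ℕ) : List ((Fin I.2.1 → ℤ) × List (Fin I.2.1 → ℤ)) :=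
  (pieces I T).map fun q => (toVec _ q.1, q.2.map (toVec _))

/-- Decoding loses nothing because all vectors in `pieces` are lists of length exactly `d`. -/
theorem reprCode_decodedPieces (T : ℕ) : reprCode (decodedPieces I T) = pieces I T := by
  rw [reprCode, decodedPieces, List.map_map]
  conv_rhs => rw [← List.map_id (pieces I T)]
  refine List.map_congr_left fun q hq => ?_
  simp only [pieces, List.mem_flatMap, List.mem_map] at hq
  obtain ⟨f, -, p, -, rfl⟩ := hq
  refine Prod.ext (vecCode_toVec (by simp [shift])) ?_
  simp only [Function.comp, List.map_map]
  conv_rhs => rw [id, ← List.map_id (columnsAt I T p)]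
  refine List.map_congr_left fun l hl => ?_
  simp only [columnsAt, List.mem_map] at hl
  obtain ⟨j, -, rfl⟩ := hl
  exact vecCode_toVec (by simp)

theorem kHoles_eq_decodedPieces {T : ℕ} (hT : Separates I T) :
    kHoles I.1 I.matrix = ⋃ q ∈ decodedPieces I T, translatedSemigroup q.1 q.2 := by
  ext b
  rw [mem_kHoles_iff_of_isSeparating ((separates_iff I T).mp hT) (fun f hf => hf.2)
    (fun b hb => by
      obtain ⟨f, h1, h2, h3⟩ := exists_zonotope_add I.matrix hb
      exact ⟨f, ⟨fun i => absSum_eq I ▸ h1 i, h2⟩, h3⟩),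
    ← exists_conePoints_iff I fun f => ∃ p : Fin I.2.2.1 → ℤ, 0 ≤ p ∧ (∀ j, p j ≤ T) ∧
      (signedPoints I.matrix {j | p j = T} (f + I.matrix *ᵥ p)).encard < I.1 ∧
      ∃ y : Fin I.2.2.1 → ℤ, 0 ≤ y ∧ (∀ j, p j ≠ T → y j = 0) ∧
        b = f + I.matrix *ᵥ p + I.matrix *ᵥ y]
  simp only [decodedPieces, pieces, Set.mem_iUnion, List.mem_map, List.mem_flatMap,
    List.mem_filter, decide_eq_true_eq]
  constructor
  · rintro ⟨f, hf, h⟩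
    obtain ⟨p, hp, h1, h2⟩ := (exists_basePoints_iff I T fun p =>
      (signedPoints I.matrix {j | p j = T} (toVec _ f + I.matrix *ᵥ p)).encard < I.1 ∧
      ∃ y : Fin I.2.2.1 → ℤ, 0 ≤ y ∧ (∀ j, p j ≠ T → y j = 0) ∧
        b = toVec _ f + I.matrix *ᵥ p + I.matrix *ᵥ y).mpr h
    rw [← toVec_shift] at h1 h2
    exact ⟨_, ⟨_, ⟨f, hf, p, ⟨hp, (countSigned_lt_iff I _ _ _).mpr h1⟩, rfl⟩, rfl⟩,
      (mem_translatedSemigroup_columns I.matrix _ b (mem_columnsAt I T p)).mpr h2⟩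
  · rintro ⟨_, ⟨_, ⟨f, hf, p, ⟨hp, h1⟩, rfl⟩, rfl⟩, hb⟩
    have h2 := (mem_translatedSemigroup_columns I.matrix _ b (mem_columnsAt I T p)).mp hb
    rw [countSigned_lt_iff] at h1
    rw [toVec_shift] at h1 h2
    obtain ⟨-, h3, h4⟩ := (mem_basePoints I).mp hp
    exact ⟨f, hf, _, h3, h4, h1, h2⟩

end Algorithm

/-! ### Integer arithmetic is primitive recursive -/

section IntPrimrec

open Encodable

/-- The parity of the code is the sign, which makes positive and negative parts primitive recursive.
-/
theorem encode_int_natCast (n : ℕ) : encode (n : ℤ) = 2 * n := rfl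

theorem encode_int_negSucc (n : ℕ) : encode (Int.negSucc n) = 2 * n + 1 := rfl

theorem primrec_int_natCast : Primrec fun n : ℕ => (n : ℤ) :=
  Primrec.encode_iff.mp (Primrec.nat_double.of_eq fun n => (encode_int_natCast n).symm)

theorem primrec_int_negSucc : Primrec Int.negSucc :=
  Primrec.encode_iff.mp (Primrec.nat_double_succ.of_eq fun n => (encode_int_negSucc n).symm)

theorem primrec_int_toNat : Primrec Int.toNat := by
  refine (Primrec.cond (Primrec.nat_bodd.comp Primrec.encode) (Primrec.const 0)
    (Primrec.nat_div2.comp Primrec.encode)).of_eq fun z => ?_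
  cases z with
  | ofNat n => simp [encode_int_natCast]
  | negSucc n => simp [encode_int_negSucc]

theorem primrec_int_toNat_neg : Primrec fun z : ℤ => (-z).toNat := by
  refine (Primrec.cond (Primrec.nat_bodd.comp Primrec.encode)
    (Primrec.succ.comp (Primrec.nat_div2.comp Primrec.encode)) (Primrec.const 0)).of_eq fun z => ?_
  cases z with
  | ofNat n => simp [encode_int_natCast]
  | negSucc n => simp [encode_int_negSucc]

theorem primrec_natCast_sub_natCast : Primrec₂ fun a b : ℕ => (a : ℤ) - b := by
  refine Primrec₂.of_eq (f := fun a b : ℕ =>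
    if b ≤ a then ((a - b : ℕ) : ℤ) else Int.negSucc (b - a - 1))
    (Primrec.ite (Primrec.nat_le.comp Primrec.snd Primrec.fst)
      (primrec_int_natCast.comp (Primrec.nat_sub.comp Primrec.fst Primrec.snd))
      (primrec_int_negSucc.comp (Primrec.nat_sub.comp
        (Primrec.nat_sub.comp Primrec.snd Primrec.fst) (Primrec.const 1)))) fun a b => ?_
  split_ifs <;> omega

/-- Splitting integers into positive and negative parts reduces the operation to natural numbers and
one final difference; multiplication is treated likewise. -/
theorem primrec_int_add : Primrec₂ fun x y : ℤ => x + y := by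
  have hp := primrec_int_toNat
  have hm := primrec_int_toNat_neg
  refine Primrec₂.of_eq (f := fun x y : ℤ =>
    ((x.toNat + y.toNat : ℕ) : ℤ) - (((-x).toNat + (-y).toNat : ℕ) : ℤ))
    (primrec_natCast_sub_natCast.comp
      (Primrec.nat_add.comp (hp.comp Primrec.fst) (hp.comp Primrec.snd))
      (Primrec.nat_add.comp (hm.comp Primrec.fst) (hm.comp Primrec.snd))) fun x y => ?_
  omega

theorem primrec_int_mul : Primrec₂ fun x y : ℤ => x * y := by
  have hp := primrec_int_toNat
  have hm := primrec_int_toNat_neg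
  refine Primrec₂.of_eq (f := fun x y : ℤ =>
    ((x.toNat * y.toNat + (-x).toNat * (-y).toNat : ℕ) : ℤ) -
      ((x.toNat * (-y).toNat + (-x).toNat * y.toNat : ℕ) : ℤ))
    (primrec_natCast_sub_natCast.comp
      (Primrec.nat_add.comp
        (Primrec.nat_mul.comp (hp.comp Primrec.fst) (hp.comp Primrec.snd))
        (Primrec.nat_mul.comp (hm.comp Primrec.fst) (hm.comp Primrec.snd)))
      (Primrec.nat_add.comp
        (Primrec.nat_mul.comp (hp.comp Primrec.fst) (hm.comp Primrec.snd))
        (Primrec.nat_mul.comp (hm.comp Primrec.fst) (hp.comp Primrec.snd)))) fun x y => ?_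
  have hx : (x.toNat : ℤ) - (-x).toNat = x := by omega
  have hy : (y.toNat : ℤ) - (-y).toNat = y := by omega
  conv_rhs => rw [← hx, ← hy]
  push_cast
  ring

theorem primrec_int_natAbs : Primrec Int.natAbs :=
  (Primrec.nat_add.comp primrec_int_toNat primrec_int_toNat_neg).of_eq fun z => by omega

theorem primrecPred_int_nonneg : PrimrecPred fun z : ℤ => 0 ≤ z :=
  (Primrec.eq.comp primrec_int_toNat_neg (Primrec.const 0)).of_eq fun z => by omega

end IntPrimrec

/-! ### Closure properties of primitive recursion -/

section Closure

variable {α β : Type*} [Primcodable α] [Primcodable β]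

theorem primrec_nat_pow : Primrec₂ fun a b : ℕ => a ^ b :=
  Primrec₂.unpaired'.mp Nat.Primrec.pow

theorem primrec_sum_range {M : Type*} [Primcodable M] [AddCommMonoid M]
    (hadd : Primrec₂ fun x y : M => x + y) {n : α → ℕ} {F : α → ℕ → M} (hn : Primrec n)
    (hF : Primrec₂ F) : Primrec fun a => ∑ j ∈ Finset.range (n a), F a j := by
  refine (Primrec.nat_rec' (g := fun _ => (0 : M)) (h := fun a (p : ℕ × M) => p.2 + F a p.1) hn
    (Primrec.const 0) ?_).of_eq fun a => ?_
  · exact hadd.comp (Primrec.snd.comp Primrec.snd)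
      (hF.comp Primrec.fst (Primrec.fst.comp Primrec.snd))
  · induction n a with
    | zero => rfl
    | succ m ih => rw [Finset.sum_range_succ, ← ih]

theorem primrecPred_forall_lt {n : α → ℕ} {R : α → ℕ → Prop} (hn : Primrec n)
    (hR : PrimrecRel R) : PrimrecPred fun a => ∀ x < n a, R a x :=
  ((PrimrecRel.forall_mem_list hR.swap).comp (Primrec.list_range.comp hn) Primrec.id).of_eq
    fun a => by simp [Function.swap]

theorem primrecPred_exists_lt {n : α → ℕ} {R : α → ℕ → Prop} (hn : Primrec n)
    (hR : PrimrecRel R) : PrimrecPred fun a => ∃ x < n a, R a x :=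
  ((PrimrecRel.exists_mem_list hR.swap).comp (Primrec.list_range.comp hn) Primrec.id).of_eq
    fun a => by simp [Function.swap]

theorem primrecPred_forall_mem {L : α → List β} {R : α → β → Prop} (hL : Primrec L)
    (hR : PrimrecRel R) : PrimrecPred fun a => ∀ x ∈ L a, R a x :=
  (PrimrecRel.forall_mem_list hR.swap).comp hL Primrec.id

theorem primrecPred_exists_mem {L : α → List β} {R : α → β → Prop} (hL : Primrec L)
    (hR : PrimrecRel R) : PrimrecPred fun a => ∃ x ∈ L a, R a x :=
  (PrimrecRel.exists_mem_list hR.swap).comp hL Primrec.id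

theorem primrec_filter {L : α → List β} {R : α → β → Prop} [∀ a, DecidablePred (R a)]
    (hL : Primrec L) (hR : PrimrecRel R) : Primrec fun a => (L a).filter (R a) := by
  let _ : DecidableRel fun (b : β) (a : α) => R a b := fun b a => inferInstanceAs (Decidable (R a b))
  exact (PrimrecRel.listFilter (R := fun b a => R a b) hR.swap).comp hL Primrec.id

/-- Unbounded search, the only step of the algorithm not shown to be primitive recursive. -/
theorem computable_natFind {R : α → ℕ → Prop} [∀ a, DecidablePred (R a)] (hR : PrimrecRel R)
    (hex : ∀ a, ∃ n, R a n) : Computable fun a => Nat.find (hex a) := by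
  let _ : DecidableRel R := inferInstance
  have h : Computable₂ fun a n => decide (R a n) := Primrec.to_comp (PrimrecRel.decide hR)
  refine (Partrec.rfind (Computable₂.partrec₂ h)).of_eq_tot fun a => ?_
  rw [Nat.mem_rfind]
  exact ⟨by simpa using Nat.find_spec (hex a), fun hm => by simpa using Nat.find_min (hex a) hm⟩

end Closure

/-! ### Computability of the algorithm -/

section AlgorithmPrimrec

variable {α : Type*} [Primcodable α]

theorem primrec_getD {l : α → List ℤ} {j : α → ℕ} (hl : Primrec l) (hj : Primrec j) :
    Primrec fun a => (l a).getD (j a) 0 :=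
  (Primrec.list_getD 0).comp hl hj

theorem primrec_entry {A : α → List (List ℤ)} {i j : α → ℕ} (hA : Primrec A) (hi : Primrec i)
    (hj : Primrec j) : Primrec fun a => entry (A a) (i a) (j a) :=
  primrec_getD ((Primrec.list_getD []).comp hA hi) hj

theorem primrec_mulEntry {n : α → ℕ} {A : α → List (List ℤ)} {x : α → List ℤ} {i : α → ℕ}
    (hn : Primrec n) (hA : Primrec A) (hx : Primrec x) (hi : Primrec i) :
    Primrec fun a => mulEntry (n a) (A a) (x a) (i a) :=
  primrec_sum_range primrec_int_add hn <| primrec_int_mul.comp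
    (primrec_entry (hA.comp Primrec.fst) (hi.comp Primrec.fst) Primrec.snd)
    (primrec_getD (hx.comp Primrec.fst) Primrec.snd)

theorem primrec_box {C n : α → ℕ} (hC : Primrec C) (hn : Primrec n) :
    Primrec fun a => box (C a) (n a) := by
  refine (Primrec.nat_rec' (g := fun _ => [[]]) (h := fun a (p : ℕ × List (List ℤ)) =>
    p.2.flatMap fun l => (List.range (2 * C a + 1)).map fun i : ℕ => ((i : ℤ) - C a) :: l) hn
    (Primrec.const _) ?_).of_eq fun a => ?_
  · refine Primrec.list_flatMap (Primrec.snd.comp Primrec.snd) ?_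
    refine Primrec.list_map (Primrec.list_range.comp (Primrec.nat_double_succ.comp
      (hC.comp (Primrec.fst.comp Primrec.fst)))) ?_
    exact Primrec.list_cons.comp (primrec_natCast_sub_natCast.comp Primrec.snd
      (hC.comp (Primrec.fst.comp (Primrec.fst.comp Primrec.fst)))) (Primrec.snd.comp Primrec.fst)
  · induction n a with
    | zero => rfl
    | succ m ih => rw [box, ← ih]

theorem primrec_kernelBound {d n e : α → ℕ} (hd : Primrec d) (hn : Primrec n) (he : Primrec e) :
    Primrec fun a => kernelBound (d a) (n a) (e a) :=
  primrec_nat_pow.comp (Primrec.nat_mul.comp hn (Primrec.succ.comp (Primrec.nat_mul.comp hd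
    (primrec_nat_pow.comp he (Primrec.const 2))))) hn

theorem primrec_boxBound {k d n e : α → ℕ} (hk : Primrec k) (hd : Primrec d) (hn : Primrec n)
    (he : Primrec e) : Primrec fun a => boxBound (k a) (d a) (n a) (e a) :=
  Primrec.nat_mul.comp (Primrec.nat_add.comp (Primrec.succ.comp hn) hk)
    (primrec_kernelBound hd (Primrec.succ.comp hn) he)

variable {I : α → Input}

theorem primrec_k (hI : Primrec I) : Primrec fun a => (I a).1 := Primrec.fst.comp hI

theorem primrec_d (hI : Primrec I) : Primrec fun a => (I a).2.1 :=
  Primrec.fst.comp (Primrec.snd.comp hI)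

theorem primrec_n (hI : Primrec I) : Primrec fun a => (I a).2.2.1 :=
  Primrec.fst.comp (Primrec.snd.comp (Primrec.snd.comp hI))

theorem primrec_rows (hI : Primrec I) : Primrec fun a => (I a).2.2.2 :=
  Primrec.snd.comp (Primrec.snd.comp (Primrec.snd.comp hI))

theorem primrec_absSum (hI : Primrec I) : Primrec fun a => absSum (I a) := by
  refine primrec_sum_range Primrec.nat_add (primrec_d hI) ?_
  refine primrec_sum_range Primrec.nat_add (primrec_n (hI.comp Primrec.fst)) ?_
  exact primrec_int_natAbs.comp (primrec_entry
    (primrec_rows (hI.comp (Primrec.fst.comp Primrec.fst))) (Primrec.snd.comp Primrec.fst)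
    Primrec.snd)

theorem primrec_sizeBound {g : α → List ℤ} (hI : Primrec I) (hg : Primrec g) :
    Primrec fun a => sizeBound (I a) (g a) :=
  Primrec.nat_add.comp (primrec_absSum hI) <|
    primrec_sum_range Primrec.nat_add (primrec_d hI) <|
      primrec_int_natAbs.comp (primrec_getD (hg.comp Primrec.fst) Primrec.snd)

theorem primrecPred_isSignedPoint {p g z : α → List ℤ} {T : α → ℕ} (hI : Primrec I)
    (hp : Primrec p) (hT : Primrec T) (hg : Primrec g) (hz : Primrec z) :
    PrimrecPred fun a => IsSignedPoint (I a) (p a) (T a) (g a) (z a) := by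
  have hI' := hI.comp (Primrec.fst (β := ℕ))
  refine PrimrecPred.and (primrecPred_forall_lt (primrec_d hI) ?_)
    (primrecPred_forall_lt (primrec_n hI) ?_)
  · exact Primrec.eq.comp
      (primrec_mulEntry (primrec_n hI') (primrec_rows hI') (hz.comp Primrec.fst) Primrec.snd)
      (primrec_getD (hg.comp Primrec.fst) Primrec.snd)
  · exact PrimrecPred.or
      (Primrec.eq.comp (primrec_getD (hp.comp Primrec.fst) Primrec.snd)
        (primrec_int_natCast.comp (hT.comp Primrec.fst)))
      (primrecPred_int_nonneg.comp (primrec_getD (hz.comp Primrec.fst) Primrec.snd))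

theorem primrec_countSigned {p g : α → List ℤ} {T : α → ℕ} (hI : Primrec I)
    (hp : Primrec p) (hT : Primrec T) (hg : Primrec g) :
    Primrec fun a => countSigned (I a) (p a) (T a) (g a) := by
  refine Primrec.list_length.comp (primrec_filter (primrec_box (primrec_boxBound (primrec_k hI)
    (primrec_d hI) (primrec_n hI) (primrec_sizeBound hI hg)) (primrec_n hI)) ?_)
  exact primrecPred_isSignedPoint (hI.comp Primrec.fst) (hp.comp Primrec.fst)
    (hT.comp Primrec.fst) (hg.comp Primrec.fst) Primrec.snd

theorem primrecPred_coneTest {f : α → List ℤ} (hI : Primrec I) (hf : Primrec f) :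
    PrimrecPred fun a => ConeTest (I a) (f a) := by
  have hK : Primrec fun a => kernelBound (I a).2.1 ((I a).2.2.1 + 1) (absSum (I a)) :=
    primrec_kernelBound (primrec_d hI) (Primrec.succ.comp (primrec_n hI)) (primrec_absSum hI)
  refine primrecPred_exists_mem (primrec_box hK (primrec_n hI)) (PrimrecPred.and ?_ ?_)
  · exact primrecPred_forall_lt (primrec_n (hI.comp Primrec.fst)) <|
      primrecPred_int_nonneg.comp (primrec_getD (Primrec.snd.comp Primrec.fst) Primrec.snd)
  · refine primrecPred_exists_lt (hK.comp Primrec.fst) ?_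
    refine primrecPred_forall_lt (primrec_d (hI.comp (Primrec.fst.comp Primrec.fst))) ?_
    have h1 := Primrec.fst.comp (Primrec.fst.comp (Primrec.fst (α := (α × List ℤ) × ℕ) (β := ℕ)))
    refine Primrec.eq.comp (primrec_mulEntry (primrec_n (hI.comp h1)) (primrec_rows (hI.comp h1))
      (Primrec.snd.comp (Primrec.fst.comp Primrec.fst)) Primrec.snd) ?_
    exact primrec_int_mul.comp (primrec_int_add.comp
      (primrec_int_natCast.comp (Primrec.snd.comp Primrec.fst)) (Primrec.const 1))
      (primrec_getD (hf.comp h1) Primrec.snd)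

theorem primrec_conePoints (hI : Primrec I) : Primrec fun a => conePoints (I a) :=
  primrec_filter (primrec_box (primrec_absSum hI) (primrec_d hI))
    (primrecPred_coneTest (hI.comp Primrec.fst) Primrec.snd)

theorem primrec_basePoints {T : α → ℕ} (hI : Primrec I) (hT : Primrec T) :
    Primrec fun a => basePoints (I a) (T a) :=
  primrec_filter (primrec_box hT (primrec_n hI)) <|
    primrecPred_forall_lt (primrec_n (hI.comp Primrec.fst)) <|
      primrecPred_int_nonneg.comp (primrec_getD (Primrec.snd.comp Primrec.fst) Primrec.snd)

theorem primrec_shift {f p : α → List ℤ} (hI : Primrec I) (hf : Primrec f) (hp : Primrec p) :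
    Primrec fun a => shift (I a) (f a) (p a) :=
  Primrec.list_map (Primrec.list_range.comp (primrec_d hI)) <|
    primrec_int_add.comp (primrec_getD (hf.comp Primrec.fst) Primrec.snd)
      (primrec_mulEntry (primrec_n (hI.comp Primrec.fst)) (primrec_rows (hI.comp Primrec.fst))
        (hp.comp Primrec.fst) Primrec.snd)

theorem primrecPred_separates {T : α → ℕ} (hI : Primrec I) (hT : Primrec T) :
    PrimrecPred fun a => Separates (I a) (T a) := by
  refine primrecPred_forall_mem (primrec_conePoints hI) ?_
  refine primrecPred_forall_mem (primrec_basePoints (hI.comp Primrec.fst) (hT.comp Primrec.fst)) ?_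
  have hI' := hI.comp (Primrec.fst.comp (Primrec.fst (α := α × List ℤ) (β := List ℤ)))
  have hT' := hT.comp (Primrec.fst.comp (Primrec.fst (α := α × List ℤ) (β := List ℤ)))
  have hg := primrec_shift hI' (Primrec.snd.comp Primrec.fst) Primrec.snd
  exact PrimrecPred.or
    (Primrec.nat_le.comp (primrec_k hI')
      (primrec_countSigned hI' (Primrec.const []) (Primrec.const 1) hg))
    (Primrec.nat_lt.comp (primrec_countSigned hI' Primrec.snd hT' hg) (primrec_k hI'))

theorem primrec_columnsAt {T : α → ℕ} {p : α → List ℤ} (hI : Primrec I) (hT : Primrec T)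
    (hp : Primrec p) : Primrec fun a => columnsAt (I a) (T a) (p a) := by
  refine Primrec.list_map (primrec_filter (Primrec.list_range.comp (primrec_n hI)) ?_) ?_
  · exact Primrec.eq.comp (primrec_getD (hp.comp Primrec.fst) Primrec.snd)
      (primrec_int_natCast.comp (hT.comp Primrec.fst))
  · exact Primrec.list_map (Primrec.list_range.comp (primrec_d (hI.comp Primrec.fst)))
      (primrec_entry (primrec_rows (hI.comp (Primrec.fst.comp Primrec.fst))) Primrec.snd
        (Primrec.snd.comp Primrec.fst))

theorem primrec_pieces {T : α → ℕ} (hI : Primrec I) (hT : Primrec T) :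
    Primrec fun a => pieces (I a) (T a) := by
  refine Primrec.list_flatMap (primrec_conePoints hI) ?_
  have hI' := hI.comp (Primrec.fst.comp (Primrec.fst (α := α × List ℤ) (β := List ℤ)))
  have hT' := hT.comp (Primrec.fst.comp (Primrec.fst (α := α × List ℤ) (β := List ℤ)))
  have hg := primrec_shift hI' (Primrec.snd.comp Primrec.fst) Primrec.snd
  refine Primrec.list_map (primrec_filter
    (primrec_basePoints (hI.comp Primrec.fst) (hT.comp Primrec.fst)) ?_) ?_
  · exact Primrec.nat_lt.comp (primrec_countSigned hI' Primrec.snd hT' hg) (primrec_k hI')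
  · exact Primrec.pair hg (primrec_columnsAt hI' hT' Primrec.snd)

/-- The `k`-hole algorithm: search for a separating level and output the pieces there. -/
def kHolesAlgorithm (I : Input) : List (List ℤ × List (List ℤ)) :=
  pieces I (Nat.find (exists_separates I))

theorem computable_kHolesAlgorithm : Computable kHolesAlgorithm := by
  have h1 : Computable₂ pieces := Primrec.to_comp (primrec_pieces Primrec.fst Primrec.snd)
  have h2 : PrimrecRel Separates := primrecPred_separates Primrec.fst Primrec.snd
  exact h1.comp Computable.id (computable_natFind h2 exists_separates)

end AlgorithmPrimrec

end KHoles

theorem mainTheorem6 :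
    ∃ alg : ℕ × ℕ × ℕ × List (List ℤ) → List (List ℤ × List (List ℤ)),
      Computable alg ∧
      ∀ (k d n : ℕ) (A : Matrix (Fin d) (Fin n) ℤ),
        ∃ R : List ((Fin d → ℤ) × List (Fin d → ℤ)),
          alg (k, d, n, KHoles.matrixCode A) = KHoles.reprCode R ∧
          KHoles.kHoles k A = ⋃ p ∈ R, KHoles.translatedSemigroup p.1 p.2 := by
  refine ⟨KHoles.kHolesAlgorithm, KHoles.computable_kHolesAlgorithm, fun k d n A => ?_⟩
  let I : KHoles.Input := (k, d, n, KHoles.matrixCode A)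
  have hA : I.matrix = A := KHoles.toMat_matrixCode A
  refine ⟨KHoles.decodedPieces I (Nat.find (KHoles.exists_separates I)),
    (KHoles.reprCode_decodedPieces I _).symm, ?_⟩
  rw [← KHoles.kHoles_eq_decodedPieces I (Nat.find_spec (KHoles.exists_separates I)), hA]
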